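/- **Theorem (global well-posedness).** Let $T>0$ and let $n,k,m$ be the state, control and backward-state dimensions. Write $\mathbb S^d$ for the symmetric real $d\times d$ matrices, $\mathbb S^d_+$ for the positive semi-definite ones, $X\le Y$ if $Y-X\in\mathbb S^d_+$, and $\Delta^*[0,T]=\{(t,s):0\le t\le s\le T\}$. Let $H\in\mathbb R^{m\times n}$ and assume the following. * **(H2)** There is $\delta>0$ such that for all $0\le t\le s\le T$: $R(t,s)\ge\delta I$, $G_2(t)\ge\delta I$, and $Q(t,s),M(t,s),N(t,s),G_1(t)\ge0$. * **(H3)** There are positive definite matrices $\widehat Q,\widehat R,\widehat M,\widehat N,\widehat G_1,\widehat G_2$ such that for all $0\le t\le\tau\le s\le T$: $F(t,s)\le F(\tau,s)\le\widehat F$ for each $F\in\{Q,R,M,N\}$, and $G_i(t)\le G_i(\tau)\le\widehat G_i$ for $i=1,2$. * **(H4)** The coefficients $A,C\in C([0,T];\mathbb R^{n\times n})$, $B,D\in C([0,T];\mathbb R^{n\times k})$, $\widehat A\in C([0,T];\mathbb R^{m\times n})$, $\widehat B\in C([0,T];\mathbb R^{m\times k})$, $\widehat C,\widehat D\in C([0,T];\mathbb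 R^{m\times m})$ are continuous. * **(H5)** $Q\in C([0,T]^2;\mathbb S^n)$, $R\in C([0,T]^2;\mathbb S^k)$, $M,N\in C([0,T]^2;\mathbb S^m)$, $G_1\in C^1([0,T];\mathbb S^n)$, $G_2\in C^1([0,T];\mathbb S^m)$, and $Q(t,s),R(t,s),M(t,s),N(t,s)$ are differentiable in $t$ over $\{0\le t\le s\le T\}$. For given $P_1(\cdot,\cdot),P_2(\cdot)$ put $$\begin{aligned}\Theta(s)=-\big[&R(s,s)+D(s)^\top\big(P_1(s,s)+P_2(s)^\top N(s,s)P_2(s)\big)D(s)\big]^{-1}\\ \times\Big[&B(s)^\top P_1(s,s)+D(s)^\top\big(P_1(s,s)+P_2(s)^\top N(s,s)P_2(s)\big)C(s)\\ &+\big(\widehat B(s)^\top+B(s)^\top P_2(s)^\top+D(s)^\top P_2(s)^\top\widehat D(s)^\top\big)G_2(s)P_2(s)\Big],\end{aligned}$$ $A_\Theta=A+B\Theta$, $C_\Theta=C+D\Theta$ and $\widehat A_\Theta=\widehat A+\widehat B\Theta$. Then the equilibrium Riccati equation $$\begin{cases}\dfrac{dP_1(t,s)}{ds}+P_1(t,s)A_\Theta(s)+A_\Theta(s)^\top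 P_1(t,s)+C_\Theta(s)^\top P_1(t,s)C_\Theta(s)+Q(t,s)+\Theta(s)^\top R(t,s)\Theta(s)\\ \quad+P_2(s)^\top M(t,s)P_2(s)+C_\Theta(s)^\top P_2(s)^\top N(t,s)P_2(s)C_\Theta(s)=0,&0\le t\le s\le T,\\[4pt] \dfrac{dP_2(s)}{ds}+P_2(s)A_\Theta(s)+\widehat A_\Theta(s)+\widehat C(s)P_2(s)+\widehat D(s)P_2(s)C_\Theta(s)=0,&0\le s\le T,\\[4pt] P_1(t,T)=G_1(t),\quad P_2(T)=H,&0\le t\le T,\end{cases}$$ admits a unique solution $(P_1,P_2)\in C(\Delta^*[0,T];\mathbb S^n_+)\times C([0,T];\mathbb R^{m\times n})$. -/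

import Mathlib

open Set
open scoped Matrix

/- `Matrix.Norms.L2Operator` puts on matrices the spectral norm, and `MatrixOrder` the Loewner
order (`X ≤ Y` if and only if `Y - X` is positive semi-definite). -/
open scoped Matrix.Norms.L2Operator MatrixOrder

/-- The data of a time-inconsistent linear-quadratic problem for a forward-backward stochastic
system with state dimensions `n` (forward) and `m` (backward) and control dimension `k`: the
horizon `T > 0`, the coefficients of the state equation (a trailing `h` stands for a hat),
the terminal matrix `H`, and the weighting matrices of the cost functional.  The functions are
defined on all of `ℝ`, but only their values on `[0,T]` (resp. `[0,T]²`) are ever used. -/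
structure LQData (n k m : ℕ) where
  T : ℝ
  T_pos : 0 < T
  A : ℝ → Matrix (Fin n) (Fin n) ℝ
  B : ℝ → Matrix (Fin n) (Fin k) ℝ
  C : ℝ → Matrix (Fin n) (Fin n) ℝ
  D : ℝ → Matrix (Fin n) (Fin k) ℝ
  Ah : ℝ → Matrix (Fin m) (Fin n) ℝ
  Bh : ℝ → Matrix (Fin m) (Fin k) ℝ
  Ch : ℝ → Matrix (Fin m) (Fin m) ℝ
  Dh : ℝ → Matrix (Fin m) (Fin m) ℝ
  H : Matrix (Fin m) (Fin n) ℝ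
  Q : ℝ → ℝ → Matrix (Fin n) (Fin n) ℝ
  R : ℝ → ℝ → Matrix (Fin k) (Fin k) ℝ
  M : ℝ → ℝ → Matrix (Fin m) (Fin m) ℝ
  N : ℝ → ℝ → Matrix (Fin m) (Fin m) ℝ
  G₁ : ℝ → Matrix (Fin n) (Fin n) ℝ
  G₂ : ℝ → Matrix (Fin m) (Fin m) ℝ

/-- Membership in `C([0,T]²; 𝕊ᵈ)`. -/
def IsContSymmKernel (T : ℝ) {d : ℕ} (F : ℝ → ℝ → Matrix (Fin d) (Fin d) ℝ) : Prop :=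
  ContinuousOn (fun p : ℝ × ℝ => F p.1 p.2) (Icc 0 T ×ˢ Icc 0 T) ∧
    ∀ t ∈ Icc 0 T, ∀ s ∈ Icc 0 T, (F t s).IsSymm

/-- Membership in `C¹([0,T]; 𝕊ᵈ)`. -/
def IsC1Symm (T : ℝ) {d : ℕ} (G : ℝ → Matrix (Fin d) (Fin d) ℝ) : Prop :=
  ContDiffOn ℝ 1 G (Icc 0 T) ∧ ∀ t ∈ Icc 0 T, (G t).IsSymm

/-- `F(t,s)` is differentiable in `t` over the triangle `0 ≤ t ≤ s ≤ T`
(one-sided derivatives at the ends of the interval `[0,s]`). -/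
def IsDiffInFirst (T : ℝ) {d : ℕ} (F : ℝ → ℝ → Matrix (Fin d) (Fin d) ℝ) : Prop :=
  ∀ s ∈ Icc 0 T, DifferentiableOn ℝ (fun t => F t s) (Icc 0 s)

namespace LQData

variable {n k m : ℕ}

/-- Positivity of the weights. -/
def WeightsPositive (L : LQData n k m) : Prop :=
  ∃ δ : ℝ, 0 < δ ∧ ∀ t s : ℝ, 0 ≤ t → t ≤ s → s ≤ L.T →
    δ • (1 : Matrix (Fin k) (Fin k) ℝ) ≤ L.R t s ∧
    δ • (1 : Matrix (Fin m) (Fin m) ℝ) ≤ L.G₂ t ∧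
    0 ≤ L.Q t s ∧ 0 ≤ L.M t s ∧ 0 ≤ L.N t s ∧ 0 ≤ L.G₁ t

/-- Monotonicity of the weights in the first time variable, and upper bounds. -/
def WeightsMonotone (L : LQData n k m) : Prop :=
  ∃ (Qh G₁h : Matrix (Fin n) (Fin n) ℝ) (Rh : Matrix (Fin k) (Fin k) ℝ)
    (Mh Nh G₂h : Matrix (Fin m) (Fin m) ℝ),
    Qh.PosDef ∧ G₁h.PosDef ∧ Rh.PosDef ∧ Mh.PosDef ∧ Nh.PosDef ∧ G₂h.PosDef ∧
    ∀ t τ s : ℝ, 0 ≤ t → t ≤ τ → τ ≤ s → s ≤ L.T →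
      (L.Q t s ≤ L.Q τ s ∧ L.Q τ s ≤ Qh) ∧
      (L.R t s ≤ L.R τ s ∧ L.R τ s ≤ Rh) ∧
      (L.M t s ≤ L.M τ s ∧ L.M τ s ≤ Mh) ∧
      (L.N t s ≤ L.N τ s ∧ L.N τ s ≤ Nh) ∧
      (L.G₁ t ≤ L.G₁ τ ∧ L.G₁ τ ≤ G₁h) ∧
      (L.G₂ t ≤ L.G₂ τ ∧ L.G₂ τ ≤ G₂h)

/-- Continuity of the coefficients of the state equation on `[0,T]`. -/
def CoeffsContinuous (L : LQData n k m) : Prop :=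
  ContinuousOn L.A (Icc 0 L.T) ∧ ContinuousOn L.B (Icc 0 L.T) ∧
  ContinuousOn L.C (Icc 0 L.T) ∧ ContinuousOn L.D (Icc 0 L.T) ∧
  ContinuousOn L.Ah (Icc 0 L.T) ∧ ContinuousOn L.Bh (Icc 0 L.T) ∧
  ContinuousOn L.Ch (Icc 0 L.T) ∧ ContinuousOn L.Dh (Icc 0 L.T)

/-- Regularity of the weights. -/
def WeightsRegular (L : LQData n k m) : Prop :=
  IsContSymmKernel L.T L.Q ∧ IsContSymmKernel L.T L.R ∧
  IsContSymmKernel L.T L.M ∧ IsContSymmKernel L.T L.N ∧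
  IsC1Symm L.T L.G₁ ∧ IsC1Symm L.T L.G₂ ∧
  IsDiffInFirst L.T L.Q ∧ IsDiffInFirst L.T L.R ∧
  IsDiffInFirst L.T L.M ∧ IsDiffInFirst L.T L.N

/-- The matrix `R(s,s) + D(s)ᵀ (P₁(s,s) + P₂(s)ᵀ N(s,s) P₂(s)) D(s)`, inverted in `Θ(s)`. -/
def gram (L : LQData n k m) (P₁ : ℝ → ℝ → Matrix (Fin n) (Fin n) ℝ)
    (P₂ : ℝ → Matrix (Fin m) (Fin n) ℝ) (s : ℝ) : Matrix (Fin k) (Fin k) ℝ :=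
  L.R s s + (L.D s)ᵀ * (P₁ s s + (P₂ s)ᵀ * L.N s s * P₂ s) * L.D s

/-- The feedback matrix `Θ(s)` determined by `(P₁, P₂)`. -/
noncomputable def Theta (L : LQData n k m) (P₁ : ℝ → ℝ → Matrix (Fin n) (Fin n) ℝ)
    (P₂ : ℝ → Matrix (Fin m) (Fin n) ℝ) (s : ℝ) : Matrix (Fin k) (Fin n) ℝ :=
  -((L.gram P₁ P₂ s)⁻¹ *
    ((L.B s)ᵀ * P₁ s s
      + (L.D s)ᵀ * (P₁ s s + (P₂ s)ᵀ * L.N s s * P₂ s) * L.C s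
      + ((L.Bh s)ᵀ + (L.B s)ᵀ * (P₂ s)ᵀ + (L.D s)ᵀ * (P₂ s)ᵀ * (L.Dh s)ᵀ) * L.G₂ s * P₂ s))

/-- `A_Θ = A + B Θ`. -/
def closedA (L : LQData n k m) (Θ : ℝ → Matrix (Fin k) (Fin n) ℝ) (s : ℝ) :
    Matrix (Fin n) (Fin n) ℝ :=
  L.A s + L.B s * Θ s

/-- `C_Θ = C + D Θ`. -/
def closedC (L : LQData n k m) (Θ : ℝ → Matrix (Fin k) (Fin n) ℝ) (s : ℝ) :
    Matrix (Fin n) (Fin n) ℝ :=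
  L.C s + L.D s * Θ s

/-- `Â_Θ = Â + B̂ Θ`. -/
def closedAh (L : LQData n k m) (Θ : ℝ → Matrix (Fin k) (Fin n) ℝ) (s : ℝ) :
    Matrix (Fin m) (Fin n) ℝ :=
  L.Ah s + L.Bh s * Θ s

/-- The sum that is added to `dP₁(t,s)/ds` in the first equation of the equilibrium Riccati
equation. -/
def drift₁ (L : LQData n k m) (P₁ : ℝ → ℝ → Matrix (Fin n) (Fin n) ℝ)
    (P₂ : ℝ → Matrix (Fin m) (Fin n) ℝ) (Θ : ℝ → Matrix (Fin k) (Fin n) ℝ) (t s : ℝ) :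
    Matrix (Fin n) (Fin n) ℝ :=
  P₁ t s * L.closedA Θ s + (L.closedA Θ s)ᵀ * P₁ t s
    + (L.closedC Θ s)ᵀ * P₁ t s * L.closedC Θ s
    + L.Q t s + (Θ s)ᵀ * L.R t s * Θ s + (P₂ s)ᵀ * L.M t s * P₂ s
    + (L.closedC Θ s)ᵀ * (P₂ s)ᵀ * L.N t s * P₂ s * L.closedC Θ s

/-- The sum that is added to `dP₂(s)/ds` in the second equation of the equilibrium Riccati
equation. -/
def drift₂ (L : LQData n k m) (P₂ : ℝ → Matrix (Fin m) (Fin n) ℝ)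
    (Θ : ℝ → Matrix (Fin k) (Fin n) ℝ) (s : ℝ) : Matrix (Fin m) (Fin n) ℝ :=
  P₂ s * L.closedA Θ s + L.closedAh Θ s + L.Ch s * P₂ s + L.Dh s * P₂ s * L.closedC Θ s

/-- `(P₁, P₂)` is a solution of the equilibrium Riccati equation on `[0,T]` in the class
`C(Δ*[0,T]; 𝕊ⁿ₊) × C([0,T]; ℝ^{m×n})`, where `Δ*[0,T]` is the triangle `0 ≤ t ≤ s ≤ T`.
Derivatives at the ends of an interval are one-sided. -/
structure IsERESolution (L : LQData n k m) (P₁ : ℝ → ℝ → Matrix (Fin n) (Fin n) ℝ)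
    (P₂ : ℝ → Matrix (Fin m) (Fin n) ℝ) : Prop where
  continuousOn₁ : ContinuousOn (fun p : ℝ × ℝ => P₁ p.1 p.2)
    {p : ℝ × ℝ | 0 ≤ p.1 ∧ p.1 ≤ p.2 ∧ p.2 ≤ L.T}
  posSemidef₁ : ∀ t s : ℝ, 0 ≤ t → t ≤ s → s ≤ L.T → (P₁ t s).PosSemidef
  continuousOn₂ : ContinuousOn P₂ (Icc 0 L.T)
  /-- the inverse matrix in the definition of `Θ` exists -/
  isUnit_gram : ∀ s ∈ Icc 0 L.T, IsUnit (L.gram P₁ P₂ s)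
  deriv₁ : ∀ t s : ℝ, 0 ≤ t → t ≤ s → s ≤ L.T →
    HasDerivWithinAt (fun r => P₁ t r) (-(L.drift₁ P₁ P₂ (L.Theta P₁ P₂) t s)) (Icc t L.T) s
  deriv₂ : ∀ s ∈ Icc 0 L.T,
    HasDerivWithinAt P₂ (-(L.drift₂ P₂ (L.Theta P₁ P₂) s)) (Icc 0 L.T) s
  terminal₁ : ∀ t ∈ Icc 0 L.T, P₁ t L.T = L.G₁ t
  terminal₂ : P₂ L.T = L.H

end LQData

/-! For every fixed `t` the first equation is a backward equation in `s`, but its coefficients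
contain the diagonal values `P₁(s,s)`. If the whole function `P₁(·,s)` is taken as unknown, the pair
`(P₁(·,s), P₂(s))` solves an ordinary differential equation in the Banach space `C([0,T]; ℝ^{n×n}) ×
ℝ^{m×n}`; the equation is posed on the square `[0,T]²` and restricted to the triangle at the end.
Its field is locally Lipschitz once the inverse in `Θ` is replaced by a globally Lipschitz map `J`
that agrees with it on `{G : G ≥ δ}`. Multiplication of the field by a cutoff of the norm makes it
bounded, so a solution exists on all of `[0,T]` (`exists_damped_solution`). What remains is an a
priori bound that does not depend on the cutoff; if the radius is at least this bound, the cutoff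
factor is identically one.

Along a solution, the cutoff is only a scalar factor `χ(s) ∈ [0,1]` in front of the drift, and it
preserves the structure used for the bound. The equation of `P₁(t,·)` is a Lyapunov equation with
positive source on the triangle, so `P₁(t,s) ≥ 0` (`quad_nonneg_of_lyapunov`). Hence the matrix
inverted in `Θ` is at least `δ`, and `J` gives its true inverse there. The same lemma, applied to
`P₁(τ,·) - P₁(t,·)`, shows that `P₁` increases in its first variable.

The bound concerns the cost `V(t,s) = P₁(t,s) + P₂(s)ᵀ G₂(t) P₂(s)` on the diagonal. There its drift
is a quadratic polynomial in the feedback, with leading coefficient `gram`, and `Θ` is exactly its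
minimiser. So the drift is at most that of the zero feedback, which grows at most linearly in the
cost (`quad_valueDrift_le`, `exists_norm_valueDrift_zero_le`). Instead of differentiating along the
diagonal, one compares `V(s,s)` with `V(s,r)` for `s < r` by the equation, and `V(s,r)` with
`V(r,r)` by monotonicity. This yields a Gronwall bound (`exists_norm_diag_le`). Since `G₂ ≥ δ`, it
controls `P₁(s,s)` and `P₂(s)`, hence `Θ`; the equation of `P₁(t,·)` then has bounded coefficients
and `P₁` is bounded on the square (`exists_norm_le`).

Uniqueness is a contraction argument in an exponentially weighted supremum norm on the triangle
(`eq_of_isERESolution`). -/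

namespace Matrix

/-! ### Quadratic forms, the spectral norm, and inverses of coercive matrices. -/

section QuadraticForm

variable {a b c : ℕ}

/-- The quadratic form `x ↦ xᵀ A x` of a square matrix. -/
def quad (A : Matrix (Fin a) (Fin a) ℝ) (x : Fin a → ℝ) : ℝ := x ⬝ᵥ A *ᵥ x

lemma quad_add (A B : Matrix (Fin a) (Fin a) ℝ) (x : Fin a → ℝ) :
    quad (A + B) x = quad A x + quad B x := by
  simp [quad, add_mulVec, dotProduct_add]

lemma quad_sub (A B : Matrix (Fin a) (Fin a) ℝ) (x : Fin a → ℝ) :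
    quad (A - B) x = quad A x - quad B x := by
  simp [quad, sub_mulVec, dotProduct_sub]

lemma quad_smul (r : ℝ) (A : Matrix (Fin a) (Fin a) ℝ) (x : Fin a → ℝ) :
    quad (r • A) x = r * quad A x := by
  simp [quad, smul_mulVec, dotProduct_smul]

lemma quad_one (x : Fin a → ℝ) : quad 1 x = x ⬝ᵥ x := by
  simp [quad]

lemma quad_conj (A : Matrix (Fin a) (Fin a) ℝ) (B : Matrix (Fin a) (Fin b) ℝ) (x : Fin b → ℝ) :
    quad (Bᵀ * A * B) x = quad A (B *ᵥ x) := by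
  simp only [quad, ← mulVec_mulVec, dotProduct_mulVec x Bᵀ, vecMul_transpose]

lemma self_dotProduct_nonneg (x : Fin a → ℝ) : 0 ≤ x ⬝ᵥ x :=
  Finset.sum_nonneg fun i _ => mul_self_nonneg (x i)

lemma norm_toLp_sq (x : Fin a → ℝ) : ‖WithLp.toLp 2 x‖ ^ 2 = x ⬝ᵥ x := by
  rw [EuclideanSpace.norm_sq_eq]
  simp [dotProduct, sq]

lemma norm_toLp_mulVec_le (A : Matrix (Fin a) (Fin b) ℝ) (x : Fin b → ℝ) :
    ‖WithLp.toLp 2 (A *ᵥ x)‖ ≤ ‖A‖ * ‖WithLp.toLp 2 x‖ :=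
  l2_opNorm_mulVec A (WithLp.toLp 2 x)

lemma dotProduct_le_norm_mul_norm (x y : Fin a → ℝ) :
    |x ⬝ᵥ y| ≤ ‖WithLp.toLp 2 x‖ * ‖WithLp.toLp 2 y‖ := by
  have h := abs_real_inner_le_norm (WithLp.toLp 2 y : EuclideanSpace ℝ (Fin a)) (WithLp.toLp 2 x)
  rw [EuclideanSpace.inner_toLp_toLp] at h
  simpa [mul_comm, dotProduct_comm] using h

lemma abs_quad_le (A : Matrix (Fin a) (Fin a) ℝ) (x : Fin a → ℝ) :
    |quad A x| ≤ ‖A‖ * (x ⬝ᵥ x) := by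
  rw [← norm_toLp_sq]
  calc |quad A x| ≤ ‖WithLp.toLp 2 x‖ * ‖WithLp.toLp 2 (A *ᵥ x)‖ :=
        dotProduct_le_norm_mul_norm _ _
    _ ≤ ‖WithLp.toLp 2 x‖ * (‖A‖ * ‖WithLp.toLp 2 x‖) := by
        gcongr; exact norm_toLp_mulVec_le A x
    _ = ‖A‖ * ‖WithLp.toLp 2 x‖ ^ 2 := by ring

lemma quad_le_norm (A : Matrix (Fin a) (Fin a) ℝ) (x : Fin a → ℝ) :
    quad A x ≤ ‖A‖ * (x ⬝ᵥ x) :=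
  (le_abs_self _).trans (abs_quad_le A x)

lemma neg_norm_le_quad (A : Matrix (Fin a) (Fin a) ℝ) (x : Fin a → ℝ) :
    -(‖A‖ * (x ⬝ᵥ x)) ≤ quad A x :=
  (abs_le.1 (abs_quad_le A x)).1

lemma norm_le_of_forall_mulVec {A : Matrix (Fin a) (Fin b) ℝ} {r : ℝ} (hr : 0 ≤ r)
    (h : ∀ x, ‖WithLp.toLp 2 (A *ᵥ x)‖ ≤ r * ‖WithLp.toLp 2 x‖) : ‖A‖ ≤ r := by
  rw [l2_opNorm_def]
  exact ContinuousLinearMap.opNorm_le_bound _ hr fun x => h x.ofLp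

lemma norm_sq_le_of_quad_le {A : Matrix (Fin a) (Fin b) ℝ} {r : ℝ} (hr : 0 ≤ r)
    (h : ∀ x, (A *ᵥ x) ⬝ᵥ (A *ᵥ x) ≤ r * (x ⬝ᵥ x)) : ‖A‖ ^ 2 ≤ r := by
  have : ‖A‖ ≤ √r := by
    refine norm_le_of_forall_mulVec (Real.sqrt_nonneg r) fun x => ?_
    refine abs_le_of_sq_le_sq' ?_ (by positivity) |>.2
    rw [mul_pow, Real.sq_sqrt hr, norm_toLp_sq, norm_toLp_sq]
    exact h x
  calc ‖A‖ ^ 2 ≤ √r ^ 2 := by gcongr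
    _ = r := Real.sq_sqrt hr

lemma posSemidef_iff_quad {A : Matrix (Fin a) (Fin a) ℝ} :
    A.PosSemidef ↔ A.IsSymm ∧ ∀ x, 0 ≤ quad A x := by
  rw [posSemidef_iff_dotProduct_mulVec, IsHermitian, conjTranspose_eq_transpose_of_trivial]
  rfl

lemma quad_le_quad {A B : Matrix (Fin a) (Fin a) ℝ} (h : A ≤ B) (x : Fin a → ℝ) :
    quad A x ≤ quad B x := by
  have := (posSemidef_iff_quad.1 (le_iff.1 h)).2 x
  rw [quad_sub] at this
  linarith

lemma quad_nonneg {A : Matrix (Fin a) (Fin a) ℝ} (h : 0 ≤ A) (x : Fin a → ℝ) : 0 ≤ quad A x := by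
  have := quad_le_quad h x
  rwa [show quad 0 x = 0 by simp [quad]] at this

lemma norm_transpose' (A : Matrix (Fin a) (Fin b) ℝ) : ‖Aᵀ‖ = ‖A‖ := by
  rw [← conjTranspose_eq_transpose_of_trivial, l2_opNorm_conjTranspose]

lemma norm_one_le : ‖(1 : Matrix (Fin a) (Fin a) ℝ)‖ ≤ 1 :=
  norm_le_of_forall_mulVec zero_le_one fun x => by simp

/-- Write `A = Bᵀ B`: then `‖A‖ = ‖B‖²`, and the quadratic form of `A` is `|Bx|²`. -/
lemma PosSemidef.norm_le_of_quad_le {A : Matrix (Fin a) (Fin a) ℝ} (hA : A.PosSemidef) {r : ℝ}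
    (hr : 0 ≤ r) (h : ∀ x, quad A x ≤ r * (x ⬝ᵥ x)) : ‖A‖ ≤ r := by
  obtain ⟨B, rfl⟩ := CStarAlgebra.nonneg_iff_eq_star_mul_self.1 hA.nonneg
  rw [star_eq_conjTranspose] at h ⊢
  rw [l2_opNorm_conjTranspose_mul_self, ← sq]
  refine norm_sq_le_of_quad_le hr fun x => ?_
  have := h x
  rwa [conjTranspose_eq_transpose_of_trivial, ← mul_one Bᵀ, quad_conj, quad_one] at this

lemma PosSemidef.transpose_mul_mul_same {A : Matrix (Fin a) (Fin a) ℝ} (hA : A.PosSemidef)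
    (B : Matrix (Fin a) (Fin b) ℝ) : (Bᵀ * A * B).PosSemidef := by
  simpa using hA.conjTranspose_mul_mul_same B

lemma isUnit_of_smul_one_le {G : Matrix (Fin a) (Fin a) ℝ} {δ : ℝ} (hδ : 0 < δ)
    (h : δ • (1 : Matrix (Fin a) (Fin a) ℝ) ≤ G) : IsUnit G := by
  have h1 : (δ • (1 : Matrix (Fin a) (Fin a) ℝ)).PosDef := PosDef.one.smul hδ
  have := h1.add_posSemidef (le_iff.1 h)
  rw [add_sub_cancel] at this
  exact this.isUnit

/-- Coercivity: with `x = G⁻¹ y`, `δ |x|² ≤ x · G x = x · y ≤ |x| |y|`. -/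
lemma norm_inv_le_of_smul_one_le {G : Matrix (Fin a) (Fin a) ℝ} {δ : ℝ} (hδ : 0 < δ)
    (h : δ • (1 : Matrix (Fin a) (Fin a) ℝ) ≤ G) : ‖G⁻¹‖ ≤ δ⁻¹ := by
  have hG := (isUnit_iff_isUnit_det G).1 (isUnit_of_smul_one_le hδ h)
  refine norm_le_of_forall_mulVec (by positivity) fun y => ?_
  set x := G⁻¹ *ᵥ y with hx
  have hy : G *ᵥ x = y := by rw [hx, mulVec_mulVec, mul_nonsing_inv _ hG, one_mulVec]
  have h1 := quad_le_quad h x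
  rw [quad_smul, quad_one, ← norm_toLp_sq, quad, hy] at h1
  have h2 := (le_abs_self _).trans (dotProduct_le_norm_mul_norm x y)
  rw [inv_mul_eq_div, le_div_iff₀ hδ]
  rcases (norm_nonneg (WithLp.toLp 2 x)).eq_or_lt with h0 | h0
  · rw [← h0, zero_mul]; positivity
  · nlinarith

lemma norm_inv_sub_inv_le {G G' : Matrix (Fin a) (Fin a) ℝ} {δ : ℝ} (hδ : 0 < δ)
    (h : δ • (1 : Matrix (Fin a) (Fin a) ℝ) ≤ G) (h' : δ • (1 : Matrix (Fin a) (Fin a) ℝ) ≤ G') :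
    ‖G⁻¹ - G'⁻¹‖ ≤ δ⁻¹ * δ⁻¹ * ‖G - G'‖ := by
  have hG := (isUnit_iff_isUnit_det G).1 (isUnit_of_smul_one_le hδ h)
  have hG' := (isUnit_iff_isUnit_det G').1 (isUnit_of_smul_one_le hδ h')
  have : G⁻¹ - G'⁻¹ = G⁻¹ * (G' - G) * G'⁻¹ := by
    rw [Matrix.mul_sub, Matrix.sub_mul, Matrix.mul_assoc, mul_nonsing_inv _ hG',
      nonsing_inv_mul _ hG, Matrix.mul_one, Matrix.one_mul]
  rw [this, norm_sub_rev G G']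
  have h1 := norm_inv_le_of_smul_one_le hδ h
  have h2 := norm_inv_le_of_smul_one_le hδ h'
  calc _ ≤ ‖G⁻¹‖ * ‖G' - G‖ * ‖G'⁻¹‖ := by
        refine (l2_opNorm_mul _ _).trans ?_
        gcongr
        exact l2_opNorm_mul _ _
    _ ≤ δ⁻¹ * ‖G' - G‖ * δ⁻¹ := by gcongr
    _ = _ := by ring

/-- A globally Lipschitz function that agrees with the inverse on the matrices `G ≥ δ`. -/
lemma exists_lipschitzWith_eq_inv (a : ℕ) {δ : ℝ} (hδ : 0 < δ) :
    ∃ (J : Matrix (Fin a) (Fin a) ℝ → Matrix (Fin a) (Fin a) ℝ) (K : NNReal), LipschitzWith K J ∧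
      ∀ G, δ • (1 : Matrix (Fin a) (Fin a) ℝ) ≤ G → J G = G⁻¹ := by
  have h : LipschitzOnWith (δ⁻¹ * δ⁻¹).toNNReal (fun G : Matrix (Fin a) (Fin a) ℝ => G⁻¹)
      {G | δ • (1 : Matrix (Fin a) (Fin a) ℝ) ≤ G} := by
    refine LipschitzOnWith.of_dist_le_mul fun G hG G' hG' => ?_
    rw [Real.coe_toNNReal _ (by positivity), dist_eq_norm, dist_eq_norm]
    exact norm_inv_sub_inv_le hδ hG hG'
  obtain ⟨J, hJ, hE⟩ := h.extend_finite_dimension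
  exact ⟨J, _, hJ, fun G hG => (hE hG).symm⟩

end QuadraticForm

end Matrix

/-! ### Continuous induction, comparison and solvability backward in time. -/

-- Continuous induction from the right end of the interval, obtained from the usual one by the
-- reflection `x ↦ -x`.
open Filter Topology in
lemma Icc_subset_of_forall_mem_nhdsLT {a b : ℝ} {S : Set ℝ} (hS : IsClosed (S ∩ Icc a b))
    (hb : b ∈ S) (h : ∀ x ∈ S ∩ Ioc a b, S ∈ 𝓝[<] x) : Icc a b ⊆ S := by
  have key : Icc (-b) (-a) ⊆ Neg.neg ⁻¹' S := by
    refine IsClosed.Icc_subset_of_forall_mem_nhdsWithin ?_ (by simpa using hb) ?_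
    · have : Neg.neg ⁻¹' S ∩ Icc (-b) (-a) = Neg.neg ⁻¹' (S ∩ Icc a b) := by
        ext x
        simp only [mem_inter_iff, mem_preimage, mem_Icc]
        constructor <;> rintro ⟨h1, h2, h3⟩ <;> exact ⟨h1, by linarith, by linarith⟩
      rw [this]
      exact hS.preimage continuous_neg
    · rintro x ⟨hx, h1, h2⟩
      have := h (-x) ⟨hx, by linarith, by linarith⟩
      have ht : Tendsto (Neg.neg : ℝ → ℝ) (𝓝[>] x) (𝓝[<] (-x)) := tendsto_neg_nhdsGT
      exact ht this
  intro x hx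
  have := key (show -x ∈ Icc (-b) (-a) from ⟨by linarith [hx.2], by linarith [hx.1]⟩)
  simpa using this

section NormedSpace

variable {E : Type*} [NormedAddCommGroup E] [NormedSpace ℝ E]

/-- The reflected fencing inequality: going backward, `‖f‖` cannot cross `B`, because wherever they
touch, `B` grows strictly faster. -/
lemma norm_le_of_norm_deriv_lt_backward {a b : ℝ} {f f' : ℝ → E} {B B' : ℝ → ℝ}
    (hf : ∀ x ∈ Icc a b, HasDerivWithinAt f (f' x) (Icc a b) x)
    (hb : ‖f b‖ ≤ B b) (hB : ∀ x, HasDerivAt B (B' x) x)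
    (bound : ∀ x ∈ Icc a b, ‖f x‖ = B x → ‖f' x‖ < -B' x) :
    ∀ x ∈ Icc a b, ‖f x‖ ≤ B x := by
  have hneg : ∀ x ∈ Icc (-b) (-a), -x ∈ Icc a b := fun x hx =>
    ⟨by linarith [hx.2], by linarith [hx.1]⟩
  have hd : ∀ x ∈ Icc (-b) (-a),
      HasDerivWithinAt (fun y => f (-y)) (-f' (-x)) (Icc (-b) (-a)) x := by
    intro x hx
    have := (hf (-x) (hneg x hx)).scomp x (hasDerivWithinAt_neg x (Icc (-b) (-a))) hneg
    simpa [Function.comp_def] using this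
  intro x hx
  have := image_norm_le_of_norm_deriv_right_lt_deriv_boundary (f := fun y => f (-y))
    (f' := fun y => -f' (-y)) (a := -b) (b := -a) (B := fun y => B (-y)) (B' := fun y => -B' (-y))
    (fun y hy => (hd y hy).continuousWithinAt)
    (fun y hy => (hd y (Ico_subset_Icc_self hy)).mono_of_mem_nhdsWithin
      (Icc_mem_nhdsGE_of_mem hy)) (by simpa using hb)
    (fun y => by simpa [Function.comp_def] using (hB (-y)).comp y (hasDerivAt_neg y))
    (fun y hy h => by
      rw [norm_neg]
      exact bound _ (hneg y (Ico_subset_Icc_self hy)) h)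
    (show -x ∈ Icc (-b) (-a) from ⟨by linarith [hx.2], by linarith [hx.1]⟩)
  simpa using this

/-- Backward Gronwall estimate for an affine differential inequality. -/
lemma norm_le_exp_of_norm_deriv_le_backward {a b : ℝ} {f f' : ℝ → E} {c K : ℝ}
    (hf : ∀ x ∈ Icc a b, HasDerivWithinAt f (f' x) (Icc a b) x) (hc : 0 < c)
    (hb : ‖f b‖ ≤ c) (bound : ∀ x ∈ Icc a b, ‖f' x‖ ≤ K * (‖f x‖ + c)) (hK : 0 ≤ K) :
    ∀ x ∈ Icc a b, ‖f x‖ ≤ c * Real.exp ((2 * K + 1) * (b - x)) := by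
  refine norm_le_of_norm_deriv_lt_backward (f' := f')
    (B' := fun x => c * (Real.exp ((2 * K + 1) * (b - x)) * ((2 * K + 1) * (-1)))) hf
    (by simpa using hb) (fun x => ?_) fun x hx h => ?_
  · exact ((((hasDerivAt_id x).const_sub b).const_mul (2 * K + 1)).exp.const_mul c)
  · refine (bound x hx).trans_lt ?_
    -- At a contact point `‖f‖ = B ≥ c`, so `K (‖f‖ + c) ≤ 2 K B < (2 K + 1) B`; the extra `1` in
    -- the rate gives the strict inequality.
    rw [h]
    have h1 : 1 ≤ Real.exp ((2 * K + 1) * (b - x)) :=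
      Real.one_le_exp (mul_nonneg (by positivity) (by linarith [hx.2]))
    have h2 : K * c ≤ K * (c * Real.exp ((2 * K + 1) * (b - x))) := by
      gcongr
      nlinarith
    have h3 : 0 < c * Real.exp ((2 * K + 1) * (b - x)) := by positivity
    nlinarith

/-- The affine estimate holds for every `c > 0`; let `c` tend to zero. -/
lemma eq_zero_of_norm_deriv_le_backward {a b : ℝ} {f f' : ℝ → E} {K : ℝ}
    (hf : ∀ x ∈ Icc a b, HasDerivWithinAt f (f' x) (Icc a b) x)
    (hb : f b = 0) (bound : ∀ x ∈ Icc a b, ‖f' x‖ ≤ K * ‖f x‖) (hK : 0 ≤ K) :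
    ∀ x ∈ Icc a b, f x = 0 := by
  intro x hx
  have key : ∀ c : ℝ, 0 < c → ‖f x‖ ≤ c * Real.exp ((2 * K + 1) * (b - x)) := fun c hc =>
    norm_le_exp_of_norm_deriv_le_backward hf hc (by simpa [hb] using hc.le)
      (fun y hy => (bound y hy).trans (by gcongr; linarith)) hK x hx
  refine norm_le_zero_iff.1 (le_of_forall_pos_le_add fun ε hε => ?_)
  have := key (ε / Real.exp ((2 * K + 1) * (b - x))) (by positivity)
  rwa [div_mul_cancel₀ _ (Real.exp_ne_zero _), ← zero_add ε] at this

/-- Global solvability, backward in time, of a differential equation whose vector field is bounded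
and Lipschitz on bounded sets. -/
lemma exists_hasDerivWithinAt_backward [CompleteSpace E] {a b : ℝ} (hab : a ≤ b) {f : ℝ → E → E}
    (x₀ : E) {L : ℝ} (hL : 0 ≤ L) (hbound : ∀ s ∈ Icc a b, ∀ x, ‖f s x‖ ≤ L)
    (hcont : ∀ x, ContinuousOn (fun s => f s x) (Icc a b))
    (hlip : ∀ r : ℝ, ∃ K : ℝ, 0 ≤ K ∧ ∀ s ∈ Icc a b, ∀ x y, ‖x‖ ≤ r → ‖y‖ ≤ r →
      ‖f s x - f s y‖ ≤ K * ‖x - y‖) :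
    ∃ α : ℝ → E, α b = x₀ ∧ ∀ s ∈ Icc a b, HasDerivWithinAt α (f s (α s)) (Icc a b) s := by
  have hLb : 0 ≤ L * (b - a) := mul_nonneg hL (by linarith)
  -- A field bounded by `L` cannot leave the ball of radius `L (b - a)` about `x₀`, so a Lipschitz
  -- constant on this ball suffices and Picard–Lindelöf covers the whole interval.
  obtain ⟨K, hK, hlip⟩ := hlip (‖x₀‖ + L * (b - a))
  have hball : ∀ x ∈ Metric.closedBall x₀ (L * (b - a)), ‖x‖ ≤ ‖x₀‖ + L * (b - a) := by
    intro x hx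
    rw [mem_closedBall_iff_norm] at hx
    linarith [norm_le_norm_add_norm_sub' x x₀]
  have hb : b ∈ Icc a b := right_mem_Icc.2 hab
  have hPL : IsPicardLindelof f (⟨b, hb⟩ : Icc a b) x₀ (L * (b - a)).toNNReal 0 L.toNNReal
      K.toNNReal := by
    refine ⟨fun s hs => ?_, fun x _ => hcont x, fun s hs x _ => ?_, ?_⟩
    · refine LipschitzOnWith.of_dist_le_mul fun x hx y hy => ?_
      rw [Real.coe_toNNReal _ hLb] at hx hy
      rw [Real.coe_toNNReal _ hK, dist_eq_norm, dist_eq_norm]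
      exact hlip s hs x y (hball x hx) (hball y hy)
    · rw [Real.coe_toNNReal _ hL]
      exact hbound s hs x
    · rw [Real.coe_toNNReal _ hLb, Real.coe_toNNReal _ hL]
      simp [hab]
  obtain ⟨α, h1, h2⟩ := hPL.exists_eq_forall_mem_Icc_hasDerivWithinAt₀
  exact ⟨α, h1, h2⟩

end NormedSpace

/-! ### Stability of the class `UnifLip` under algebraic operations. -/

/-- A family of maps `f a : E → F`, continuous in the parameter, bounded and Lipschitz on bounded
sets uniformly in the parameter. -/
structure UnifLip {α E F : Type*} [TopologicalSpace α] [NormedAddCommGroup E]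
    [NormedAddCommGroup F] (f : α → E → F) : Prop where
  cont : ∀ x, Continuous fun a => f a x
  lip : ∀ r : ℝ, ∃ K : ℝ, 0 ≤ K ∧ ∀ a x y, ‖x‖ ≤ r → ‖y‖ ≤ r →
    ‖f a x‖ ≤ K ∧ ‖f a x - f a y‖ ≤ K * ‖x - y‖

namespace UnifLip

variable {α E F G : Type*} [TopologicalSpace α] [NormedAddCommGroup E] [NormedAddCommGroup F]
  [NormedAddCommGroup G] {k l p : ℕ}

lemma const [CompactSpace α] {c : α → F} (hc : Continuous c) :
    UnifLip (fun a (_ : E) => c a) := by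
  refine ⟨fun _ => hc, fun r => ?_⟩
  obtain ⟨K, hK⟩ := isCompact_univ.exists_bound_of_continuousOn hc.continuousOn
  refine ⟨max K 0, le_max_right _ _, fun a x y _ _ =>
    ⟨(hK a (mem_univ a)).trans (le_max_left _ _), ?_⟩⟩
  rw [sub_self, norm_zero]
  positivity

lemma of_norm_le {g : E → F} (h : ∀ x y, ‖g x - g y‖ ≤ ‖x - y‖) (h0 : g 0 = 0) :
    UnifLip (fun (_ : α) => g) := by
  refine ⟨fun _ => continuous_const, fun r => ⟨max r 1, by positivity, fun a x y hx _ => ⟨?_, ?_⟩⟩⟩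
  · simpa [h0] using ((h x 0).trans (by simpa using hx)).trans (le_max_left r 1)
  · exact (h x y).trans (le_mul_of_one_le_left (norm_nonneg _) (le_max_right _ _))

lemma add {f g : α → E → F} (hf : UnifLip f) (hg : UnifLip g) :
    UnifLip (fun a x => f a x + g a x) := by
  refine ⟨fun x => (hf.cont x).add (hg.cont x), fun r => ?_⟩
  obtain ⟨K, hK, h1⟩ := hf.lip r
  obtain ⟨K', hK', h2⟩ := hg.lip r
  refine ⟨K + K', by positivity, fun a x y hx hy => ⟨?_, ?_⟩⟩
  · exact (norm_add_le _ _).trans (add_le_add (h1 a x y hx hy).1 (h2 a x y hx hy).1)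
  · rw [add_sub_add_comm, add_mul]
    exact (norm_add_le _ _).trans (add_le_add (h1 a x y hx hy).2 (h2 a x y hx hy).2)

lemma comp_lipschitz {J : F → G} {K : NNReal} (hJ : LipschitzWith K J) {f : α → E → F}
    (hf : UnifLip f) : UnifLip (fun a x => J (f a x)) := by
  refine ⟨fun x => hJ.continuous.comp (hf.cont x), fun r => ?_⟩
  obtain ⟨M, hM, h⟩ := hf.lip r
  refine ⟨‖J 0‖ + K * M, by positivity, fun a x y hx hy => ⟨?_, ?_⟩⟩
  · have h1 := hJ.norm_sub_le (f a x) 0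
    rw [sub_zero] at h1
    have h2 : (K : ℝ) * ‖f a x‖ ≤ K * M := by gcongr; exact (h a x y hx hy).1
    linarith [norm_le_norm_add_norm_sub' (J (f a x)) (J 0)]
  · have h1 := hJ.norm_sub_le (f a x) (f a y)
    have h2 : (K : ℝ) * ‖f a x - f a y‖ ≤ K * (M * ‖x - y‖) := by
      gcongr; exact (h a x y hx hy).2
    nlinarith [norm_nonneg (J 0), norm_nonneg (x - y)]

lemma neg {f : α → E → F} (hf : UnifLip f) : UnifLip (fun a x => -f a x) :=
  comp_lipschitz (K := 1) (J := fun x : F => -x) (LipschitzWith.id.neg) hf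

lemma transpose {f : α → E → Matrix (Fin k) (Fin l) ℝ} (hf : UnifLip f) :
    UnifLip (fun a x => (f a x)ᵀ) := by
  refine ⟨fun x => (hf.cont x).matrix_transpose, fun r => ?_⟩
  obtain ⟨M, hM, h⟩ := hf.lip r
  refine ⟨M, hM, fun a x y hx hy => ?_⟩
  rw [← Matrix.transpose_sub, Matrix.norm_transpose', Matrix.norm_transpose']
  exact h a x y hx hy

/-- The product rule for an abstract bilinear operation, serving both matrix products and scalar
multiples. -/
lemma mul_aux {B : F → G → E} (hsub : ∀ x x' y y', B x y - B x' y' = B (x - x') y + B x' (y - y'))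
    (hB : ∀ x y, ‖B x y‖ ≤ ‖x‖ * ‖y‖) {H : Type*} [NormedAddCommGroup H] {f : α → H → F}
    {g : α → H → G} (hf : UnifLip f) (hg : UnifLip g)
    (hcont : ∀ x, Continuous fun a => B (f a x) (g a x)) :
    UnifLip (fun a x => B (f a x) (g a x)) := by
  refine ⟨hcont, fun r => ?_⟩
  obtain ⟨K, hK, h1⟩ := hf.lip r
  obtain ⟨K', hK', h2⟩ := hg.lip r
  refine ⟨K * K' + K * K', by positivity, fun a x y hx hy => ⟨?_, ?_⟩⟩
  · have : ‖f a x‖ * ‖g a x‖ ≤ K * K' := by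
      gcongr
      · exact (h1 a x y hx hy).1
      · exact (h2 a x y hx hy).1
    have := hB (f a x) (g a x)
    nlinarith [mul_nonneg hK hK']
  · rw [hsub, add_mul]
    refine (norm_add_le _ _).trans (add_le_add ((hB _ _).trans ?_) ((hB _ _).trans ?_))
    · calc _ ≤ (K * ‖x - y‖) * K' := by
            gcongr
            · exact (h1 a x y hx hy).2
            · exact (h2 a x y hx hy).1
        _ = _ := by ring
    · calc _ ≤ K * (K' * ‖x - y‖) := by
            gcongr
            · exact (h1 a y x hy hx).1
            · exact (h2 a x y hx hy).2
        _ = _ := by ring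

lemma mul {f : α → E → Matrix (Fin k) (Fin l) ℝ} {g : α → E → Matrix (Fin l) (Fin p) ℝ}
    (hf : UnifLip f) (hg : UnifLip g) : UnifLip (fun a x => f a x * g a x) :=
  mul_aux (B := fun X Y => X * Y) (fun x x' y y' => by
    rw [Matrix.sub_mul, Matrix.mul_sub, sub_add_sub_cancel]) Matrix.l2_opNorm_mul hf hg
    fun x => (hf.cont x).matrix_mul (hg.cont x)

lemma smul [NormedSpace ℝ F] {c : E → ℝ} (hc : UnifLip (fun (_ : α) => c)) {f : α → E → F}
    (hf : UnifLip f) : UnifLip (fun a x => c x • f a x) :=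
  mul_aux (B := fun (r : ℝ) (y : F) => r • y) (fun x x' y y' => by
    rw [sub_smul, smul_sub, sub_add_sub_cancel]) (fun x y => (norm_smul x y).le) hc hf
    fun x => (hc.cont x).smul (hf.cont x)

lemma comp_param {β : Type*} [TopologicalSpace β] {f : α → E → F} (hf : UnifLip f) {e : β → α}
    (he : Continuous e) : UnifLip (fun b x => f (e b) x) := by
  refine ⟨fun x => (hf.cont x).comp he, fun r => ?_⟩
  obtain ⟨K, hK, h⟩ := hf.lip r
  exact ⟨K, hK, fun b => h (e b)⟩

/-- Composition with a map into the domain that is `1`-Lipschitz and depends on the parameter. -/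
lemma comp_left {f : α → F → G} (hf : UnifLip f) {g : α → E → F} (hg : ∀ a, g a 0 = 0)
    (hg' : ∀ a x y, ‖g a x - g a y‖ ≤ ‖x - y‖) (hcont : ∀ x, Continuous fun a => f a (g a x)) :
    UnifLip (fun a x => f a (g a x)) := by
  refine ⟨hcont, fun r => ?_⟩
  obtain ⟨K, hK, h⟩ := hf.lip r
  have hle : ∀ a x, ‖x‖ ≤ r → ‖g a x‖ ≤ r := fun a x hx => by
    have := hg' a x 0
    rw [hg, sub_zero, sub_zero] at this
    exact this.trans hx
  refine ⟨K, hK, fun a x y hx hy => ⟨(h a _ _ (hle a x hx) (hle a y hy)).1, ?_⟩⟩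
  refine (h a _ _ (hle a x hx) (hle a y hy)).2.trans ?_
  gcongr
  exact hg' a x y

/-- Near `a₀` the Lipschitz constant is uniform, so `f a (y a)` is close to `f a (y a₀)`, and
continuity in the parameter does the rest. -/
lemma continuous_comp {f : α → E → F} (hf : UnifLip f) {y : α → E} (hy : Continuous y) :
    Continuous fun a => f a (y a) := by
  refine continuous_iff_continuousAt.2 fun a₀ => ?_
  obtain ⟨K, hK, h⟩ := hf.lip (‖y a₀‖ + 1)
  have h1 : ∀ᶠ a in nhds a₀, ‖y a‖ ≤ ‖y a₀‖ + 1 :=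
    (hy.norm.continuousAt.eventually_lt_const (lt_add_one _)).mono fun _ => le_of_lt
  have h2 : Filter.Tendsto (fun a => K * ‖y a - y a₀‖ + ‖f a (y a₀) - f a₀ (y a₀)‖) (nhds a₀)
      (nhds 0) := by
    have : Continuous fun a => K * ‖y a - y a₀‖ + ‖f a (y a₀) - f a₀ (y a₀)‖ :=
      (continuous_const.mul (hy.sub continuous_const).norm).add
        ((hf.cont _).sub continuous_const).norm
    simpa using this.tendsto a₀
  rw [ContinuousAt, tendsto_iff_norm_sub_tendsto_zero]
  refine squeeze_zero' (Filter.Eventually.of_forall fun _ => norm_nonneg _) ?_ h2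
  filter_upwards [h1] with a ha
  calc _ ≤ ‖f a (y a) - f a (y a₀)‖ + ‖f a (y a₀) - f a₀ (y a₀)‖ := norm_sub_le_norm_sub_add_norm_sub ..
    _ ≤ _ := by gcongr; exact (h a _ _ ha (by linarith)).2

end UnifLip

namespace UnifLip

variable {α β E F G : Type*} [TopologicalSpace α] [TopologicalSpace β] [NormedAddCommGroup E]
  [NormedAddCommGroup F] [NormedAddCommGroup G]

lemma prodMk {f : α → E → F} {g : α → E → G} (hf : UnifLip f) (hg : UnifLip g) :
    UnifLip (fun a x => (f a x, g a x)) := by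
  refine ⟨fun x => (hf.cont x).prodMk (hg.cont x), fun r => ?_⟩
  obtain ⟨K, hK, h1⟩ := hf.lip r
  obtain ⟨K', hK', h2⟩ := hg.lip r
  refine ⟨max K K', le_max_of_le_left hK, fun a x y hx hy => ⟨?_, ?_⟩⟩
  · exact max_le_max (h1 a x y hx hy).1 (h2 a x y hx hy).1
  · refine max_le ((h1 a x y hx hy).2.trans ?_) ((h2 a x y hx hy).2.trans ?_) <;> gcongr
    · exact le_max_left _ _
    · exact le_max_right _ _

/-- Currying a family with respect to one compact parameter. -/
lemma toContinuousMap [CompactSpace β] {f : β × α → E → F} (hf : UnifLip f) :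
    UnifLip (fun a x => (⟨fun b => f (b, a) x, (hf.cont x).comp (by fun_prop)⟩ : C(β, F))) := by
  refine ⟨fun x => ?_, fun r => ?_⟩
  · exact (ContinuousMap.curry ⟨fun q : α × β => f (q.2, q.1) x,
      (hf.cont x).comp (by fun_prop)⟩).continuous
  · obtain ⟨K, hK, h⟩ := hf.lip r
    refine ⟨K, hK, fun a x y hx hy => ⟨?_, ?_⟩⟩
    · exact (ContinuousMap.norm_le _ hK).2 fun b => (h (b, a) x y hx hy).1
    · exact (ContinuousMap.norm_le _ (by positivity)).2 fun b => (h (b, a) x y hx hy).2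

end UnifLip

/-! ### The cutoff, and the damped system as an equation in a Banach space. -/

/-- The cutoff factor `1` on the ball of radius `ρ` and `0` outside the ball of radius `ρ + 1`. -/
def cutoff {E : Type*} [NormedAddCommGroup E] (ρ : ℝ) (x : E) : ℝ := max 0 (min 1 (ρ + 1 - ‖x‖))

section Cutoff

variable {E : Type*} [NormedAddCommGroup E] {ρ : ℝ} {x : E}

lemma cutoff_nonneg : 0 ≤ cutoff ρ x := le_max_left _ _

lemma cutoff_le_one : cutoff ρ x ≤ 1 := max_le zero_le_one (min_le_left _ _)

lemma cutoff_eq_one (h : ‖x‖ ≤ ρ) : cutoff ρ x = 1 := by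
  unfold cutoff
  rw [min_eq_left (by linarith), max_eq_right zero_le_one]

lemma cutoff_eq_zero (h : ρ + 1 ≤ ‖x‖) : cutoff ρ x = 0 := by
  unfold cutoff
  rw [max_eq_left ((min_le_right _ _).trans (by linarith))]

lemma abs_cutoff_sub_le (x y : E) : |cutoff ρ x - cutoff ρ y| ≤ ‖x - y‖ := by
  have h1 := abs_max_sub_max_le_abs (min 1 (ρ + 1 - ‖x‖)) (min 1 (ρ + 1 - ‖y‖)) 0
  have h2 := abs_min_sub_min_le_max 1 (ρ + 1 - ‖x‖) 1 (ρ + 1 - ‖y‖)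
  rw [max_comm _ 0, max_comm _ 0] at h1
  refine h1.trans (h2.trans (max_le (by simp) ?_))
  rw [sub_sub_sub_cancel_left, abs_sub_comm]
  exact abs_norm_sub_norm_le x y

lemma continuous_cutoff : Continuous fun x : E => cutoff ρ x := by
  unfold cutoff
  fun_prop

lemma unifLip_cutoff {α E : Type*} [TopologicalSpace α] [NormedAddCommGroup E] (ρ : ℝ) :
    UnifLip (fun (_ : α) (x : E) => cutoff ρ x) := by
  refine ⟨fun _ => continuous_const, fun r => ⟨1, zero_le_one, fun a x y _ _ => ⟨?_, ?_⟩⟩⟩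
  · exact (Real.norm_of_nonneg cutoff_nonneg).trans_le cutoff_le_one
  · rw [one_mul]
    exact abs_cutoff_sub_le x y

end Cutoff

/-- A backward differential system for a family `p t`, `t ∈ [0,T]`, and a function `q`, whose right
side at time `s` depends on `p t s`, `p s s` and `q s`, can be solved on `[0,T]` after multiplication
of the right side with a factor that is `1` as long as the solution stays in a given ball. -/
lemma exists_damped_solution {T : ℝ} (hT : 0 ≤ T) {V W : Type*} [NormedAddCommGroup V]
    [NormedSpace ℝ V] [CompleteSpace V] [NormedAddCommGroup W] [NormedSpace ℝ W] [CompleteSpace W]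
    {f₁ : Icc 0 T × Icc 0 T → V × V × W → V} {f₂ : Icc 0 T × Icc 0 T → V × V × W → W}
    (h₁ : UnifLip f₁) (h₂ : UnifLip f₂) {G : ℝ → V} (hG : ContinuousOn G (Icc 0 T)) (H : W)
    (ρ : ℝ) :
    ∃ (χ : ℝ → ℝ) (p : ℝ → ℝ → V) (q : ℝ → W),
      ContinuousOn χ (Icc 0 T) ∧ (∀ s, 0 ≤ χ s) ∧ (∀ s, χ s ≤ 1) ∧
      ContinuousOn (fun a : ℝ × ℝ => p a.1 a.2) (Icc 0 T ×ˢ Icc 0 T) ∧ ContinuousOn q (Icc 0 T) ∧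
      (∀ t s : Icc 0 T, HasDerivWithinAt (fun r => p t r)
        (-(χ s • f₁ (t, s) (p t s, p s s, q s))) (Icc 0 T) s) ∧
      (∀ s : Icc 0 T, HasDerivWithinAt q (-(χ s • f₂ (s, s) (p s s, p s s, q s))) (Icc 0 T) s) ∧
      (∀ t ∈ Icc 0 T, p t T = G t) ∧ q T = H ∧
      ∀ s, 0 ≤ ρ → (∀ t ∈ Icc 0 T, ‖p t s‖ ≤ ρ) → ‖q s‖ ≤ ρ → χ s = 1 := by
  -- The unknown at time `s` is `X = (p(·,s), q(s))` in `C([0,T], V) × W`; for `a = (t,s)`, `g`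
  -- reads off the three values `p(t,s)`, `p(s,s)`, `q(s)`. Evaluation is linear with norm at most
  -- one.
  let g : Icc 0 T × Icc 0 T → C(Icc 0 T, V) × W → V × V × W := fun a X => (X.1 a.1, X.1 a.2, X.2)
  have hg0 : ∀ a, g a 0 = 0 := fun _ => rfl
  have hg1 : ∀ a x y, ‖g a x - g a y‖ ≤ ‖x - y‖ := fun a x y =>
    max_le (((x - y).1.norm_coe_le_norm a.1).trans (norm_fst_le (x - y)))
      (max_le (((x - y).1.norm_coe_le_norm a.2).trans (norm_fst_le (x - y)))
        (norm_snd_le (x - y)))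
  have hgc : ∀ x, Continuous fun a => g a x := fun x => by fun_prop
  have h₁' := h₁.comp_left hg0 hg1 fun x => h₁.continuous_comp (hgc x)
  have h₂' := (h₂.comp_left hg0 hg1 fun x => h₂.continuous_comp (hgc x)).comp_param
    (e := fun s : Icc 0 T => (s, s)) (by fun_prop)
  obtain ⟨F, hFdef, hF⟩ : ∃ F : Icc 0 T → C(Icc 0 T, V) × W → C(Icc 0 T, V) × W,
      (∀ s X, (∀ t, (F s X).1 t = f₁ (t, s) (g (t, s) X))
        ∧ (F s X).2 = f₂ (s, s) (g (s, s) X)) ∧ UnifLip F :=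
    ⟨_, fun s X => ⟨fun t => rfl, rfl⟩, h₁'.toContinuousMap.prodMk h₂'⟩
  have hχF := ((unifLip_cutoff ρ).smul hF).neg
  obtain ⟨M, hM, hMF⟩ := hF.lip (ρ + 1)
  obtain ⟨X, hX0, hX⟩ := exists_hasDerivWithinAt_backward hT
    (f := fun s x => -(cutoff ρ x • F (projIcc 0 T hT s) x))
    (⟨fun t => G t, continuousOn_iff_continuous_domRestrict.1 hG⟩, H) hM
    -- Boundedness: `M` bounds the field on the ball of radius `ρ + 1`, and the cutoff vanishes
    -- outside it.
    (fun s _ x => by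
      rw [norm_neg, norm_smul, Real.norm_of_nonneg cutoff_nonneg]
      rcases le_total ‖x‖ (ρ + 1) with h | h
      · calc _ ≤ 1 * M :=
              mul_le_mul cutoff_le_one (hMF _ x x h h).1 (norm_nonneg _) zero_le_one
          _ = M := one_mul M
      · rw [cutoff_eq_zero h, zero_mul]
        exact hM)
    (fun x => ((hχF.cont x).comp continuous_projIcc).continuousOn)
    (fun r => by
      obtain ⟨K', hK', h⟩ := hχF.lip r
      exact ⟨K', hK', fun s _ x y hx hy => (h _ x y hx hy).2⟩)
  have hXc : ContinuousOn X (Icc 0 T) := fun s hs => (hX s hs).continuousWithinAt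
  have hc₁ : ContinuousOn (fun p : ℝ × ℝ => (X p.2).1 (projIcc 0 T hT p.1))
      (Icc 0 T ×ˢ Icc 0 T) := by
    have h1 : ContinuousOn (fun p : ℝ × ℝ => (X p.2).1) (Icc 0 T ×ˢ Icc 0 T) :=
      (hXc.comp continuousOn_snd fun p hp => hp.2).fst
    exact h1.eval (continuous_projIcc.comp continuous_fst).continuousOn
  refine ⟨fun s => cutoff ρ (X s), fun t s => (X s).1 (projIcc 0 T hT t), fun s => (X s).2,
    continuous_cutoff.comp_continuousOn hXc, fun s => cutoff_nonneg, fun s => cutoff_le_one, hc₁,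
    hXc.snd, fun t s => ?_, fun s => ?_, fun t ht => ?_, ?_, fun s hρ h1 h2 => ?_⟩
  · have h2 : HasDerivWithinAt (fun r => (X r).1)
        (-(cutoff ρ (X s) • F (projIcc 0 T hT s) (X s))).1 (Icc 0 T) s :=
      (hasFDerivAt_fst.comp_hasDerivWithinAt (s : ℝ) (hX s s.2) :)
    -- Evaluation at `t` is a continuous linear map, so it turns the derivative in `C([0,T], V)`
    -- into the derivative of `p(t,·)`.
    have h3 := (ContinuousMap.evalCLM ℝ
      (projIcc 0 T hT t)).hasFDerivAt.comp_hasDerivWithinAt (s : ℝ) h2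
    have h4 : (ContinuousMap.evalCLM ℝ (projIcc 0 T hT t))
        (-(cutoff ρ (X s) • F (projIcc 0 T hT s) (X s))).1 =
        -(cutoff ρ (X s) • (F (projIcc 0 T hT s) (X s)).1 (projIcc 0 T hT t)) := rfl
    rw [h4, (hFdef _ _).1, projIcc_val hT s, projIcc_val hT t] at h3
    simp only [projIcc_val]
    exact h3
  · have h2 : HasDerivWithinAt (fun r => (X r).2)
        (-(cutoff ρ (X s) • F (projIcc 0 T hT s) (X s))).2 (Icc 0 T) s :=
      (hasFDerivAt_snd.comp_hasDerivWithinAt (s : ℝ) (hX s s.2) :)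
    have h4 : (-(cutoff ρ (X s) • F (projIcc 0 T hT s) (X s))).2 =
        -(cutoff ρ (X s) • (F (projIcc 0 T hT s) (X s)).2) := rfl
    rw [h4, (hFdef _ _).2, projIcc_val hT s] at h2
    simp only [projIcc_val]
    exact h2
  · simp only [hX0, projIcc_of_mem hT ht]
    rfl
  · simp only [hX0]
  · exact cutoff_eq_one (max_le ((ContinuousMap.norm_le _ hρ).2 fun t => by
      simpa using h1 t t.2) h2)

/-! ### The Riccati system as a damped flow with a regularised inverse. -/

namespace LQData

variable {n k m : ℕ}

/-- The feedback matrix as a function of the values `P₁(s,s)` and `P₂(s)`, with the inverse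
replaced by a function `J`. -/
def regTheta (L : LQData n k m) (J : Matrix (Fin k) (Fin k) ℝ → Matrix (Fin k) (Fin k) ℝ) (s : ℝ)
    (d : Matrix (Fin n) (Fin n) ℝ) (q : Matrix (Fin m) (Fin n) ℝ) : Matrix (Fin k) (Fin n) ℝ :=
  -(J (L.R s s + (L.D s)ᵀ * (d + qᵀ * L.N s s * q) * L.D s) *
    ((L.B s)ᵀ * d + (L.D s)ᵀ * (d + qᵀ * L.N s s * q) * L.C s
      + ((L.Bh s)ᵀ + (L.B s)ᵀ * qᵀ + (L.D s)ᵀ * qᵀ * (L.Dh s)ᵀ) * L.G₂ s * q))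

lemma regTheta_eq_Theta (L : LQData n k m)
    {J : Matrix (Fin k) (Fin k) ℝ → Matrix (Fin k) (Fin k) ℝ}
    {P₁ : ℝ → ℝ → Matrix (Fin n) (Fin n) ℝ} {P₂ : ℝ → Matrix (Fin m) (Fin n) ℝ} {s : ℝ}
    (h : J (L.gram P₁ P₂ s) = (L.gram P₁ P₂ s)⁻¹) :
    L.regTheta J s (P₁ s s) (P₂ s) = L.Theta P₁ P₂ s := by
  rw [Theta, ← h]
  rfl

/-- The drift of `P₁(t,s)` as a function of the values `P₁(t,s)`, `P₁(s,s)` and `P₂(s)`. -/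
def field₁ (L : LQData n k m) (J : Matrix (Fin k) (Fin k) ℝ → Matrix (Fin k) (Fin k) ℝ) (t s : ℝ)
    (y : Matrix (Fin n) (Fin n) ℝ × Matrix (Fin n) (Fin n) ℝ × Matrix (Fin m) (Fin n) ℝ) :
    Matrix (Fin n) (Fin n) ℝ :=
  L.drift₁ (fun _ _ => y.1) (fun _ => y.2.2) (fun _ => L.regTheta J s y.2.1 y.2.2) t s

/-- The drift of `P₂(s)` as a function of the values `P₁(s,s)` and `P₂(s)`. -/
def field₂ (L : LQData n k m) (J : Matrix (Fin k) (Fin k) ℝ → Matrix (Fin k) (Fin k) ℝ) (s : ℝ)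
    (y : Matrix (Fin n) (Fin n) ℝ × Matrix (Fin n) (Fin n) ℝ × Matrix (Fin m) (Fin n) ℝ) :
    Matrix (Fin m) (Fin n) ℝ :=
  L.drift₂ (fun _ => y.2.2) (fun _ => L.regTheta J s y.2.1 y.2.2) s

section Lipschitz

variable {L : LQData n k m} {J : Matrix (Fin k) (Fin k) ℝ → Matrix (Fin k) (Fin k) ℝ}
  {K : NNReal}

lemma unifLip_coeff {p l : ℕ} {T : ℝ} {E : Type*} [NormedAddCommGroup E]
    {A : ℝ → Matrix (Fin p) (Fin l) ℝ} (hA : ContinuousOn A (Icc 0 T)) :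
    UnifLip (fun (a : Icc 0 T × Icc 0 T) (_ : E) => A a.2) :=
  UnifLip.const (c := fun a : Icc 0 T × Icc 0 T => A a.2)
    ((continuousOn_iff_continuous_domRestrict.1 hA).comp continuous_snd)

lemma unifLip_kernel {p : ℕ} {T : ℝ} {E : Type*} [NormedAddCommGroup E]
    {A : ℝ → ℝ → Matrix (Fin p) (Fin p) ℝ} (hA : IsContSymmKernel T A) :
    UnifLip (fun (a : Icc 0 T × Icc 0 T) (_ : E) => A a.1 a.2) :=
  UnifLip.const (c := fun a : Icc 0 T × Icc 0 T => A a.1 a.2)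
    (hA.1.comp_continuous (f := fun a : Icc 0 T × Icc 0 T => ((a.1 : ℝ), (a.2 : ℝ)))
      (by fun_prop) fun a => ⟨a.1.2, a.2.2⟩)

lemma unifLip_fst {α E F : Type*} [TopologicalSpace α] [NormedAddCommGroup E]
    [NormedAddCommGroup F] : UnifLip (fun (_ : α) (y : E × F) => y.1) :=
  UnifLip.of_norm_le (fun x y => norm_fst_le (x - y)) rfl

lemma unifLip_snd_fst {α E F G : Type*} [TopologicalSpace α] [NormedAddCommGroup E]
    [NormedAddCommGroup F] [NormedAddCommGroup G] :
    UnifLip (fun (_ : α) (y : E × F × G) => y.2.1) :=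
  UnifLip.of_norm_le (fun x y => (norm_fst_le (x - y).2).trans (norm_snd_le (x - y))) rfl

lemma unifLip_snd_snd {α E F G : Type*} [TopologicalSpace α] [NormedAddCommGroup E]
    [NormedAddCommGroup F] [NormedAddCommGroup G] :
    UnifLip (fun (_ : α) (y : E × F × G) => y.2.2) :=
  UnifLip.of_norm_le (fun x y => (norm_snd_le (x - y).2).trans (norm_snd_le (x - y))) rfl

lemma diag_kernel {p : ℕ} {T : ℝ} {A : ℝ → ℝ → Matrix (Fin p) (Fin p) ℝ}
    (hA : IsContSymmKernel T A) : ContinuousOn (fun s => A s s) (Icc 0 T) :=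
  hA.1.comp (f := fun s : ℝ => (s, s)) (by fun_prop) fun s hs => ⟨hs, hs⟩

lemma unifLip_regTheta (hcoef : L.CoeffsContinuous) (hreg : L.WeightsRegular)
    (hJ : LipschitzWith K J) :
    UnifLip (fun (a : Icc 0 L.T × Icc 0 L.T) (y : Matrix (Fin n) (Fin n) ℝ ×
      Matrix (Fin n) (Fin n) ℝ × Matrix (Fin m) (Fin n) ℝ) =>
        L.regTheta J a.2 y.2.1 y.2.2) := by
  obtain ⟨hA, hB, hC, hD, hAh, hBh, hCh, hDh⟩ := hcoef
  obtain ⟨hQ, hR, hM, hN, hG₁, hG₂, -⟩ := hreg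
  have hX := unifLip_snd_fst.add ((unifLip_snd_snd.transpose.mul
    (unifLip_coeff (diag_kernel hN))).mul
    (unifLip_snd_snd (E := Matrix (Fin n) (Fin n) ℝ) (F := Matrix (Fin n) (Fin n) ℝ)))
  exact (UnifLip.mul (UnifLip.comp_lipschitz hJ ((unifLip_coeff (diag_kernel hR)).add
    (((unifLip_coeff hD).transpose.mul hX).mul (unifLip_coeff hD))))
    ((((unifLip_coeff hB).transpose.mul unifLip_snd_fst).add
      (((unifLip_coeff hD).transpose.mul hX).mul (unifLip_coeff hC))).add
      (((((unifLip_coeff hBh).transpose.add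
        ((unifLip_coeff hB).transpose.mul unifLip_snd_snd.transpose)).add
        (((unifLip_coeff hD).transpose.mul unifLip_snd_snd.transpose).mul
          (unifLip_coeff hDh).transpose)).mul (unifLip_coeff hG₂.1.continuousOn)).mul
            unifLip_snd_snd))).neg

lemma unifLip_field₁ (hcoef : L.CoeffsContinuous) (hreg : L.WeightsRegular)
    (hJ : LipschitzWith K J) :
    UnifLip (fun a : Icc 0 L.T × Icc 0 L.T => L.field₁ J a.1 a.2) := by
  have hΘ := unifLip_regTheta hcoef hreg hJ
  obtain ⟨hA, hB, hC, hD, hAh, hBh, hCh, hDh⟩ := hcoef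
  obtain ⟨hQ, hR, hM, hN, hG₁, hG₂, -⟩ := hreg
  have hAΘ := (unifLip_coeff hA).add ((unifLip_coeff hB).mul hΘ)
  have hCΘ := (unifLip_coeff hC).add ((unifLip_coeff hD).mul hΘ)
  exact ((((((unifLip_fst.mul hAΘ).add (hAΘ.transpose.mul unifLip_fst)).add
    ((hCΘ.transpose.mul unifLip_fst).mul hCΘ)).add (unifLip_kernel hQ)).add
    ((hΘ.transpose.mul (unifLip_kernel hR)).mul hΘ)).add
    ((unifLip_snd_snd.transpose.mul (unifLip_kernel hM)).mul unifLip_snd_snd)).add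
    ((((hCΘ.transpose.mul unifLip_snd_snd.transpose).mul (unifLip_kernel hN)).mul
      unifLip_snd_snd).mul hCΘ)

lemma unifLip_field₂ (hcoef : L.CoeffsContinuous) (hreg : L.WeightsRegular)
    (hJ : LipschitzWith K J) :
    UnifLip (fun a : Icc 0 L.T × Icc 0 L.T => L.field₂ J a.2) := by
  have hΘ := unifLip_regTheta hcoef hreg hJ
  obtain ⟨hA, hB, hC, hD, hAh, hBh, hCh, hDh⟩ := hcoef
  have hAΘ := (unifLip_coeff hA).add ((unifLip_coeff hB).mul hΘ)
  have hCΘ := (unifLip_coeff hC).add ((unifLip_coeff hD).mul hΘ)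
  have hAhΘ := (unifLip_coeff hAh).add ((unifLip_coeff hBh).mul hΘ)
  exact (((unifLip_snd_snd.mul hAΘ).add hAhΘ).add
    ((unifLip_coeff hCh).mul unifLip_snd_snd)).add
    (((unifLip_coeff hDh).mul unifLip_snd_snd).mul hCΘ)

end Lipschitz

/-- A backward solution on the square `[0,T]²` of the Riccati system with feedback `Θ`, in which the
drift is multiplied by a scalar factor `χ`. -/
structure IsDampedFlow (L : LQData n k m) (χ : ℝ → ℝ) (Θ : ℝ → Matrix (Fin k) (Fin n) ℝ)
    (P₁ : ℝ → ℝ → Matrix (Fin n) (Fin n) ℝ) (P₂ : ℝ → Matrix (Fin m) (Fin n) ℝ) : Prop where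
  cont_factor : ContinuousOn χ (Icc 0 L.T)
  factor_nonneg : ∀ s, 0 ≤ χ s
  factor_le_one : ∀ s, χ s ≤ 1
  cont_feedback : ContinuousOn Θ (Icc 0 L.T)
  cont₁ : ContinuousOn (fun p : ℝ × ℝ => P₁ p.1 p.2) (Icc 0 L.T ×ˢ Icc 0 L.T)
  cont₂ : ContinuousOn P₂ (Icc 0 L.T)
  deriv₁ : ∀ t ∈ Icc 0 L.T, ∀ s ∈ Icc 0 L.T,
    HasDerivWithinAt (fun r => P₁ t r) (-(χ s • L.drift₁ P₁ P₂ Θ t s)) (Icc 0 L.T) s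
  deriv₂ : ∀ s ∈ Icc 0 L.T, HasDerivWithinAt P₂ (-(χ s • L.drift₂ P₂ Θ s)) (Icc 0 L.T) s
  terminal₁ : ∀ t ∈ Icc 0 L.T, P₁ t L.T = L.G₁ t
  terminal₂ : P₂ L.T = L.H

lemma field₁_eq (L : LQData n k m) {J : Matrix (Fin k) (Fin k) ℝ → Matrix (Fin k) (Fin k) ℝ}
    (P₁ : ℝ → ℝ → Matrix (Fin n) (Fin n) ℝ) (P₂ : ℝ → Matrix (Fin m) (Fin n) ℝ) (t s : ℝ) :
    L.field₁ J t s (P₁ t s, P₁ s s, P₂ s) =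
      L.drift₁ P₁ P₂ (fun s => L.regTheta J s (P₁ s s) (P₂ s)) t s := by
  simp only [field₁, drift₁, closedA, closedC]

lemma field₂_eq (L : LQData n k m) {J : Matrix (Fin k) (Fin k) ℝ → Matrix (Fin k) (Fin k) ℝ}
    (P₁ : ℝ → ℝ → Matrix (Fin n) (Fin n) ℝ) (P₂ : ℝ → Matrix (Fin m) (Fin n) ℝ) (s : ℝ) :
    L.field₂ J s (P₁ s s, P₁ s s, P₂ s) =
      L.drift₂ P₂ (fun s => L.regTheta J s (P₁ s s) (P₂ s)) s := by
  simp only [field₂, drift₂, closedA, closedAh, closedC]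

/-- Solvable for every `ρ`, without any positivity: `J` is defined everywhere and the cutoff
prevents blow-up. The flow solves the true equation as soon as `χ = 1` and `J` inverts `gram`. -/
lemma exists_isDampedFlow {L : LQData n k m} (hcoef : L.CoeffsContinuous)
    (hreg : L.WeightsRegular) {J : Matrix (Fin k) (Fin k) ℝ → Matrix (Fin k) (Fin k) ℝ}
    {K : NNReal} (hJ : LipschitzWith K J) (ρ : ℝ) :
    ∃ (χ : ℝ → ℝ) (P₁ : ℝ → ℝ → Matrix (Fin n) (Fin n) ℝ) (P₂ : ℝ → Matrix (Fin m) (Fin n) ℝ),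
      L.IsDampedFlow χ (fun s => L.regTheta J s (P₁ s s) (P₂ s)) P₁ P₂ ∧
      ∀ s, 0 ≤ ρ → (∀ t ∈ Icc 0 L.T, ‖P₁ t s‖ ≤ ρ) → ‖P₂ s‖ ≤ ρ → χ s = 1 := by
  obtain ⟨χ, P₁, P₂, hχ, h0, h1, hc₁, hc₂, hd₁, hd₂, ht₁, ht₂, hρ⟩ := exists_damped_solution
    L.T_pos.le (unifLip_field₁ hcoef hreg hJ) (unifLip_field₂ hcoef hreg hJ)
    hreg.2.2.2.2.1.1.continuousOn L.H ρ
  refine ⟨χ, P₁, P₂, ⟨hχ, h0, h1, ?_, hc₁, hc₂, fun t ht s hs => ?_,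
    fun s hs => ?_, ht₁, ht₂⟩, hρ⟩
  · have hdiag : ContinuousOn (fun s => P₁ s s) (Icc 0 L.T) :=
      hc₁.comp (f := fun s : ℝ => (s, s)) (by fun_prop) fun s hs => ⟨hs, hs⟩
    rw [continuousOn_iff_continuous_domRestrict] at hdiag hc₂ ⊢
    have key := ((unifLip_regTheta hcoef hreg hJ).comp_param
      (e := fun s : Icc 0 L.T => (s, s)) (by fun_prop)).continuous_comp
      (y := fun s : Icc 0 L.T => (P₁ s s, P₁ s s, P₂ s)) (hdiag.prodMk (hdiag.prodMk hc₂))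
    exact key
  · rw [← field₁_eq (J := J)]
    exact hd₁ ⟨t, ht⟩ ⟨s, hs⟩
  · rw [← field₂_eq (J := J) (P₁ := P₁)]
    exact hd₂ ⟨s, hs⟩

end LQData

/-! ### Matrix calculus, and positivity for backward Lyapunov equations. -/

namespace Matrix

section Calculus

variable {a b c : ℕ}

/-- Matrix multiplication as a continuous bilinear map. -/
noncomputable def mulCLM (a b c : ℕ) : Matrix (Fin a) (Fin b) ℝ →L[ℝ]
    Matrix (Fin b) (Fin c) ℝ →L[ℝ] Matrix (Fin a) (Fin c) ℝ :=
  LinearMap.mkContinuous₂ (LinearMap.mk₂ ℝ (fun X Y => X * Y) Matrix.add_mul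
    (fun r X Y => Matrix.smul_mul r X Y) Matrix.mul_add fun r X Y => Matrix.mul_smul X r Y) 1
    fun X Y => by simpa using l2_opNorm_mul X Y

lemma _root_.HasDerivWithinAt.matrix_mul {X : ℝ → Matrix (Fin a) (Fin b) ℝ}
    {Y : ℝ → Matrix (Fin b) (Fin c) ℝ} {X' Y'} {u : Set ℝ} {s : ℝ}
    (hX : HasDerivWithinAt X X' u s) (hY : HasDerivWithinAt Y Y' u s) :
    HasDerivWithinAt (fun r => X r * Y r) (X s * Y' + X' * Y s) u s :=
  (mulCLM a b c).hasDerivWithinAt_of_bilinear hX hY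

lemma _root_.HasDerivWithinAt.matrix_transpose {X : ℝ → Matrix (Fin a) (Fin b) ℝ} {X'} {u : Set ℝ}
    {s : ℝ} (hX : HasDerivWithinAt X X' u s) : HasDerivWithinAt (fun r => (X r)ᵀ) X'ᵀ u s :=
  ((LinearMap.toContinuousLinearMap
    (transposeLinearEquiv (Fin a) (Fin b) ℝ ℝ).toLinearMap).hasFDerivAt.comp_hasDerivWithinAt s hX :)

lemma _root_.ContinuousOn.matrix_mul {α : Type*} [TopologicalSpace α]
    {X : α → Matrix (Fin a) (Fin b) ℝ} {Y : α → Matrix (Fin b) (Fin c) ℝ} {u : Set α}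
    (hX : ContinuousOn X u) (hY : ContinuousOn Y u) : ContinuousOn (fun r => X r * Y r) u := by
  rw [continuousOn_iff_continuous_domRestrict] at *
  exact hX.matrix_mul hY

lemma _root_.ContinuousOn.matrix_transpose {α : Type*} [TopologicalSpace α]
    {X : α → Matrix (Fin a) (Fin b) ℝ} {u : Set α} (hX : ContinuousOn X u) :
    ContinuousOn (fun r => (X r)ᵀ) u := by
  rw [continuousOn_iff_continuous_domRestrict] at *
  exact hX.matrix_transpose

lemma continuous_quad (x : Fin a → ℝ) :
    Continuous fun A : Matrix (Fin a) (Fin a) ℝ => quad A x :=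
  continuous_const.dotProduct (continuous_id.matrix_mulVec continuous_const)

lemma l2_opNorm_mul_le_of_le {X : Matrix (Fin a) (Fin b) ℝ} {Y : Matrix (Fin b) (Fin c) ℝ} {r r' : ℝ}
    (hX : ‖X‖ ≤ r) (hY : ‖Y‖ ≤ r') : ‖X * Y‖ ≤ r * r' :=
  (l2_opNorm_mul X Y).trans
    (mul_le_mul hX hY (norm_nonneg _) ((norm_nonneg _).trans hX))

end Calculus

section Lyapunov

variable {d : ℕ}

/-- The Lyapunov operator `P ↦ P A + Aᵀ P + Cᵀ P C`. -/
def lyap (A C P : Matrix (Fin d) (Fin d) ℝ) : Matrix (Fin d) (Fin d) ℝ :=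
  P * A + Aᵀ * P + Cᵀ * P * C

lemma lyap_add (A C P P' : Matrix (Fin d) (Fin d) ℝ) :
    lyap A C (P + P') = lyap A C P + lyap A C P' := by
  simp only [lyap, Matrix.add_mul, Matrix.mul_add]
  abel

lemma lyap_sub (A C P P' : Matrix (Fin d) (Fin d) ℝ) :
    lyap A C (P - P') = lyap A C P - lyap A C P' := by
  simp only [lyap, Matrix.sub_mul, Matrix.mul_sub]
  abel

lemma lyap_smul (A C P : Matrix (Fin d) (Fin d) ℝ) (r : ℝ) :
    lyap A C (r • P) = r • lyap A C P := by
  simp only [lyap, Matrix.smul_mul, Matrix.mul_smul, smul_add]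

lemma lyap_transpose (A C P : Matrix (Fin d) (Fin d) ℝ) :
    lyap A C Pᵀ = (lyap A C P)ᵀ := by
  simp only [lyap, transpose_add, transpose_mul, transpose_transpose, Matrix.mul_assoc]
  abel

lemma norm_lyap_le {A C : Matrix (Fin d) (Fin d) ℝ} {α γ : ℝ} (hA : ‖A‖ ≤ α) (hC : ‖C‖ ≤ γ)
    (P : Matrix (Fin d) (Fin d) ℝ) : ‖lyap A C P‖ ≤ (2 * α + γ ^ 2) * ‖P‖ := by
  have hA' := hA
  have hC' := hC
  rw [← norm_transpose'] at hA' hC'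
  refine (norm_add_le_of_le (norm_add_le_of_le (l2_opNorm_mul_le_of_le le_rfl hA)
    (l2_opNorm_mul_le_of_le hA' le_rfl)) (l2_opNorm_mul_le_of_le (l2_opNorm_mul_le_of_le hC' le_rfl) hC)).trans ?_
  apply le_of_eq
  ring

open Filter Topology in
/-- Positivity of backward solutions of a Lyapunov equation with positive source. -/
lemma quad_nonneg_of_lyapunov {a b α γ : ℝ} {P A C S : ℝ → Matrix (Fin d) (Fin d) ℝ} {χ : ℝ → ℝ}
    (hχ₀ : ∀ s, 0 ≤ χ s) (hχ₁ : ∀ s, χ s ≤ 1) (hA : ∀ s ∈ Icc a b, ‖A s‖ ≤ α)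
    (hC : ∀ s ∈ Icc a b, ‖C s‖ ≤ γ) (hS : ∀ s ∈ Icc a b, ∀ x, 0 ≤ quad (S s) x)
    (hP : ∀ s ∈ Icc a b,
      HasDerivWithinAt P (-(χ s • (lyap (A s) (C s) (P s) + S s))) (Icc a b) s)
    (hb : ∀ x, 0 ≤ quad (P b) x) : ∀ s ∈ Icc a b, ∀ x, 0 ≤ quad (P s) x := by
  intro s hs x
  -- `P` is perturbed by `ε exp(l (b - s))` times the identity. The rate exceeds the growth bound
  -- `2α + γ²` of the Lyapunov operator by one, which leaves a strictly positive margin; at the end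
  -- `ε` tends to zero.
  set l := 2 * α + γ ^ 2 + 1 with hl
  have hα : 0 ≤ α := (norm_nonneg _).trans (hA s hs)
  suffices key : ∀ ε : ℝ, 0 < ε → Icc a b ⊆
      {s | ∀ x, 0 ≤ quad (P s + (ε * Real.exp (l * (b - s))) • 1) x} by
    refine le_of_forall_pos_le_add fun ε hε => ?_
    have hpos : 0 < Real.exp (l * (b - s)) * (1 + x ⬝ᵥ x) :=
      mul_pos (Real.exp_pos _) (by linarith [self_dotProduct_nonneg x])
    have h1 := key (ε / (Real.exp (l * (b - s)) * (1 + x ⬝ᵥ x))) (by positivity) hs x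
    rw [quad_add, quad_smul, quad_one] at h1
    have h2 : ε / (Real.exp (l * (b - s)) * (1 + x ⬝ᵥ x)) * Real.exp (l * (b - s)) * (x ⬝ᵥ x) ≤ ε := by
      rw [div_mul_eq_mul_div, div_mul_eq_mul_div, div_le_iff₀ hpos]
      nlinarith [mul_pos hε (Real.exp_pos (l * (b - s)))]
    linarith
  intro ε hε
  set e : ℝ → ℝ := fun s => ε * Real.exp (l * (b - s)) with he
  have he_pos : ∀ s, 0 < e s := fun s => by positivity
  have hed : ∀ s, HasDerivAt e (-(l * e s)) s := fun s => by
    have := (((hasDerivAt_id' s).const_sub b).const_mul l).exp.const_mul ε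
    exact this.congr_deriv (by simp only [he]; ring)
  have hPe : ∀ s ∈ Icc a b, HasDerivWithinAt (fun s => P s + e s • (1 : Matrix (Fin d) (Fin d) ℝ))
      (-(χ s • (lyap (A s) (C s) (P s) + S s)) + (-(l * e s)) • 1) (Icc a b) s := fun s hs =>
    (hP s hs).add ((hed s).hasDerivWithinAt.smul_const 1)
  refine Icc_subset_of_forall_mem_nhdsLT ?_ ?_ ?_
  · have : {s | ∀ x, 0 ≤ quad (P s + e s • 1) x} ∩ Icc a b =
        ⋂ x, Icc a b ∩ (fun s => quad (P s + e s • 1) x) ⁻¹' Ici 0 := by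
      ext s
      simp only [mem_inter_iff, mem_ofPred_eq, mem_iInter, mem_preimage, mem_Ici]
      exact ⟨fun h x => ⟨h.2, h.1 x⟩, fun h => ⟨fun x => (h x).2, (h 0).1⟩⟩
    rw [this]
    refine isClosed_iInter fun x => ?_
    exact ((continuous_quad x).comp_continuousOn fun s hs =>
      (hPe s hs).continuousWithinAt).preimage_isClosed_of_isClosed isClosed_Icc isClosed_Ici
  · intro x
    rw [quad_add, quad_smul, quad_one]
    have := hb x
    have := mul_nonneg (he_pos b).le (self_dotProduct_nonneg x)
    linarith
  · rintro r ⟨hr, hra, hrb⟩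
    have hrm : r ∈ Icc a b := ⟨hra.le, hrb⟩
    set P₀ := P r + e r • (1 : Matrix (Fin d) (Fin d) ℝ) with hP₀
    replace hr : ∀ x, 0 ≤ quad P₀ x := hr
    set X := χ r • (lyap (A r) (C r) P₀ + S r) with hX
    set Z := -(χ r • (lyap (A r) (C r) (P r) + S r)) + (-(l * e r)) •
      (1 : Matrix (Fin d) (Fin d) ℝ) + X with hZ
    have hZ' : Z = e r • (χ r • lyap (A r) (C r) 1 - l • 1) := by
      rw [hZ, hX, hP₀, lyap_add, lyap_smul]
      simp only [smul_add, smul_sub, neg_smul, smul_smul, mul_comm l, mul_comm (χ r)]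
      abel
    -- `Z` is the part of the derivative not explained by the equation with `P₀` in place of `P r`;
    -- the surplus of `l` makes it at most `-e r`. Going back by `h` thus gains `h e(r)`, against
    -- which the errors are weighed.
    have hZq : ∀ x, quad Z x ≤ -(e r * (x ⬝ᵥ x)) := by
      intro x
      have h1 := quad_le_norm (lyap (A r) (C r) 1) x
      have h2 : ‖lyap (A r) (C r) 1‖ ≤ 2 * α + γ ^ 2 :=
        (norm_lyap_le (hA r hrm) (hC r hrm) 1).trans
          (mul_le_of_le_one_right (by positivity) norm_one_le)
      have hx := self_dotProduct_nonneg x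
      have h3 : quad (lyap (A r) (C r) 1) x ≤ (2 * α + γ ^ 2) * (x ⬝ᵥ x) := h1.trans (by gcongr)
      have h4 : χ r * quad (lyap (A r) (C r) 1) x ≤ (2 * α + γ ^ 2) * (x ⬝ᵥ x) := by
        calc _ ≤ χ r * ((2 * α + γ ^ 2) * (x ⬝ᵥ x)) := by gcongr; exact hχ₀ r
          _ ≤ 1 * ((2 * α + γ ^ 2) * (x ⬝ᵥ x)) := by gcongr; exact hχ₁ r
          _ = _ := one_mul _
      rw [hZ', quad_smul, quad_sub, quad_smul, quad_smul, quad_one, hl]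
      have := mul_le_mul_of_nonneg_left h4 (he_pos r).le
      nlinarith
    have hlin : HasDerivAt (fun s => (r - s) • X) (-X) r := by
      simpa using ((hasDerivAt_id r).const_sub r).smul_const X
    have hf : HasDerivWithinAt (fun s => P s + e s • (1 : Matrix (Fin d) (Fin d) ℝ) - (r - s) • X)
        Z (Icc a b) r := by
      have := (hPe r hrm).sub hlin.hasDerivWithinAt
      rwa [sub_neg_eq_add] at this
    have hle : 𝓝[<] r ≤ 𝓝[Icc a b] r := nhdsWithin_le_of_mem (Icc_mem_nhdsLT_of_mem ⟨hra, hrb⟩)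
    have ho := (hasDerivWithinAt_iff_isLittleO.1 hf).def (show 0 < e r / 4 by linarith [he_pos r])
    set Y := (A r)ᵀ * P₀ * A r with hY
    have hsmall : ∀ᶠ s in 𝓝[<] r, (r - s) * ‖Y‖ < e r / 4 := by
      have : Tendsto (fun s => (r - s) * ‖Y‖) (𝓝[<] r) (𝓝 ((r - r) * ‖Y‖)) :=
        ((continuous_const.sub continuous_id).mul continuous_const).continuousAt.mono_left
          nhdsWithin_le_nhds
      exact this.eventually_lt_const (by rw [sub_self, zero_mul]; linarith [he_pos r])
    -- The neighbourhood is chosen before `x`, so positivity holds for all `x` at once; both errors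
    -- are bounded by `h (e r / 4) |x|²`.
    filter_upwards [hle ho, self_mem_nhdsWithin, hsmall] with s h1 h2 h3 x
    rw [mem_Iio] at h2
    set h := r - s with hh
    have hpos : 0 < h := by linarith
    have hx := self_dotProduct_nonneg x
    set Rm := P s + e s • (1 : Matrix (Fin d) (Fin d) ℝ) - h • X -
      (P r + e r • 1 - (r - r) • X) - (s - r) • Z with hRm
    have hR : -(e r / 4 * h * (x ⬝ᵥ x)) ≤ quad Rm x := by
      refine le_trans ?_ (neg_norm_le_quad Rm x)
      have : ‖Rm‖ ≤ e r / 4 * h := by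
        rwa [Real.norm_eq_abs, abs_sub_comm, abs_of_pos hpos] at h1
      have := mul_le_mul_of_nonneg_right this hx
      linarith
    -- An Euler step preserves positivity up to second order: completing `P₀ + hχ (P₀ A + Aᵀ P₀)` to
    -- a congruence of `P₀` costs only `(hχ)² Aᵀ P₀ A`.
    have hsq : P₀ + h • X = (1 + (h * χ r) • A r)ᵀ * P₀ * (1 + (h * χ r) • A r)
        + (h * χ r) • ((C r)ᵀ * P₀ * C r) + (h * χ r) • S r - (h * χ r) ^ 2 • Y := by
      simp only [hX, hY, lyap, transpose_add, transpose_one, transpose_smul, Matrix.add_mul,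
        Matrix.mul_add, Matrix.one_mul, Matrix.mul_one, Matrix.smul_mul, Matrix.mul_smul, smul_add,
        smul_smul, sq]
      abel
    have hdecomp : P s + e s • (1 : Matrix (Fin d) (Fin d) ℝ) = Rm + (P₀ + h • X) - h • Z := by
      rw [hRm, hP₀, sub_self r, zero_smul, sub_zero, show s - r = -h by rw [hh]; ring, neg_smul]
      abel
    have hYq : (h * χ r) ^ 2 * quad Y x ≤ h * (e r / 4) * (x ⬝ᵥ x) := by
      have h5 := quad_le_norm Y x
      have h6 : (h * χ r) ^ 2 ≤ h ^ 2 := by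
        have : h * χ r ≤ h := mul_le_of_le_one_right hpos.le (hχ₁ r)
        have h7 : 0 ≤ h * χ r := mul_nonneg hpos.le (hχ₀ r)
        gcongr
      calc _ ≤ (h * χ r) ^ 2 * (‖Y‖ * (x ⬝ᵥ x)) := by gcongr
        _ ≤ h ^ 2 * (‖Y‖ * (x ⬝ᵥ x)) := by gcongr
        _ = h * (h * ‖Y‖) * (x ⬝ᵥ x) := by ring
        _ ≤ _ := by gcongr
    have hc : 0 ≤ h * χ r := mul_nonneg hpos.le (hχ₀ r)
    have hz := mul_le_mul_of_nonneg_left (hZq x) hpos.le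
    have hP₀q := hr ((1 + (h * χ r) • A r) *ᵥ x)
    have hC₀q := mul_nonneg hc (hr (C r *ᵥ x))
    have hSq := mul_nonneg hc (hS r hrm x)
    change 0 ≤ quad (P s + e s • 1) x
    clear_value Rm
    rw [hdecomp, hsq, quad_sub, quad_add, quad_sub, quad_add, quad_add, quad_conj, quad_smul,
      quad_smul, quad_smul, quad_smul, quad_conj]
    have : 0 ≤ h * e r * (x ⬝ᵥ x) := by have := he_pos r; positivity
    nlinarith

end Lyapunov

end Matrix

/-! ### Drift of the quadratic cost; symmetry, positivity and monotonicity of the flow. -/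

namespace LQData

open Matrix

variable {n k m : ℕ}

/-- The part of the drift of `P₁` that does not depend on `P₁`. -/
def source (L : LQData n k m) (P₂ : ℝ → Matrix (Fin m) (Fin n) ℝ)
    (Θ : ℝ → Matrix (Fin k) (Fin n) ℝ) (t s : ℝ) : Matrix (Fin n) (Fin n) ℝ :=
  L.Q t s + (Θ s)ᵀ * L.R t s * Θ s + (P₂ s)ᵀ * L.M t s * P₂ s
    + (P₂ s * L.closedC Θ s)ᵀ * L.N t s * (P₂ s * L.closedC Θ s)

/-- The quadratic cost `P₁(t,s) + P₂(s)ᵀ G₂(t) P₂(s)`. -/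
def value (L : LQData n k m) (P₁ : ℝ → ℝ → Matrix (Fin n) (Fin n) ℝ)
    (P₂ : ℝ → Matrix (Fin m) (Fin n) ℝ) (t s : ℝ) : Matrix (Fin n) (Fin n) ℝ :=
  P₁ t s + (P₂ s)ᵀ * L.G₂ t * P₂ s

/-- The negative of the derivative of the quadratic cost in `s`. -/
def valueDrift (L : LQData n k m) (P₁ : ℝ → ℝ → Matrix (Fin n) (Fin n) ℝ)
    (P₂ : ℝ → Matrix (Fin m) (Fin n) ℝ) (Θ : ℝ → Matrix (Fin k) (Fin n) ℝ) (t s : ℝ) :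
    Matrix (Fin n) (Fin n) ℝ :=
  L.drift₁ P₁ P₂ Θ t s + ((P₂ s)ᵀ * L.G₂ t * L.drift₂ P₂ Θ s + (L.drift₂ P₂ Θ s)ᵀ * L.G₂ t * P₂ s)

/-- The matrix multiplied by `-gram⁻¹` in the definition of `Theta`. -/
def crossTerm (L : LQData n k m) (P₁ : ℝ → ℝ → Matrix (Fin n) (Fin n) ℝ)
    (P₂ : ℝ → Matrix (Fin m) (Fin n) ℝ) (s : ℝ) : Matrix (Fin k) (Fin n) ℝ :=
  (L.B s)ᵀ * P₁ s s
    + (L.D s)ᵀ * (P₁ s s + (P₂ s)ᵀ * L.N s s * P₂ s) * L.C s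
    + ((L.Bh s)ᵀ + (L.B s)ᵀ * (P₂ s)ᵀ + (L.D s)ᵀ * (P₂ s)ᵀ * (L.Dh s)ᵀ) * L.G₂ s * P₂ s

variable {L : LQData n k m} {χ : ℝ → ℝ} {Θ : ℝ → Matrix (Fin k) (Fin n) ℝ}
  {P₁ : ℝ → ℝ → Matrix (Fin n) (Fin n) ℝ} {P₂ : ℝ → Matrix (Fin m) (Fin n) ℝ}

lemma drift₁_eq_lyap_add_source (t s : ℝ) :
    L.drift₁ P₁ P₂ Θ t s =
      lyap (L.closedA Θ s) (L.closedC Θ s) (P₁ t s) + L.source P₂ Θ t s := by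
  simp only [drift₁, source, lyap, transpose_mul, Matrix.mul_assoc]
  abel

lemma gram_isSymm {s : ℝ} (hP : (P₁ s s).IsSymm) (hN : (L.N s s).IsSymm) (hR : (L.R s s).IsSymm) :
    (L.gram P₁ P₂ s).IsSymm := by
  have hP' : (P₁ s s)ᵀ = P₁ s s := hP
  have hN' : (L.N s s)ᵀ = L.N s s := hN
  have hR' : (L.R s s)ᵀ = L.R s s := hR
  simp only [IsSymm, gram, transpose_add, transpose_mul, transpose_transpose, hP', hN', hR',
    Matrix.mul_assoc]

lemma smul_one_le_gram {s δ : ℝ} (hP : (P₁ s s).PosSemidef) (hN : 0 ≤ L.N s s)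
    (hR : δ • (1 : Matrix (Fin k) (Fin k) ℝ) ≤ L.R s s) :
    δ • (1 : Matrix (Fin k) (Fin k) ℝ) ≤ L.gram P₁ P₂ s := by
  refine hR.trans (le_add_of_nonneg_right ?_)
  rw [nonneg_iff_posSemidef] at hN ⊢
  exact (hP.add (hN.transpose_mul_mul_same _)).transpose_mul_mul_same _

/-- At `t = s` the drift of the cost is a quadratic polynomial in the feedback. The quadratic part
`gram` comes from `R`, `P₁` and `N`; the drift of `P₂` is affine in `Θ` and contributes only to the
cross term. -/
lemma valueDrift_eq_add {s : ℝ} (hP : (P₁ s s).IsSymm) (hN : (L.N s s).IsSymm)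
    (hG : (L.G₂ s).IsSymm) :
    L.valueDrift P₁ P₂ Θ s s = L.valueDrift P₁ P₂ 0 s s + ((Θ s)ᵀ * L.gram P₁ P₂ s * Θ s +
      (Θ s)ᵀ * L.crossTerm P₁ P₂ s + (L.crossTerm P₁ P₂ s)ᵀ * Θ s) := by
  have hP' : (P₁ s s)ᵀ = P₁ s s := hP
  have hN' : (L.N s s)ᵀ = L.N s s := hN
  have hG' : (L.G₂ s)ᵀ = L.G₂ s := hG
  simp only [valueDrift, drift₁, drift₂, closedA, closedC, closedAh, gram, crossTerm,
    transpose_add, transpose_mul, transpose_transpose, hP', hN', hG', Matrix.mul_add,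
    Matrix.add_mul, Matrix.mul_assoc, Pi.zero_apply, transpose_zero, Matrix.mul_zero,
    Matrix.zero_mul, add_zero]
  abel

/-- `Θ` satisfies `gram Θ = -crossTerm`, so it minimises the quadratic polynomial, and the drift is
that of zero feedback minus `Θᵀ gram Θ ≥ 0`. -/
lemma quad_valueDrift_le {s : ℝ} (hP : (P₁ s s).IsSymm) (hN : (L.N s s).IsSymm)
    (hG : (L.G₂ s).IsSymm) (hsymm : (L.gram P₁ P₂ s).IsSymm) (hgram : 0 ≤ L.gram P₁ P₂ s)
    (hunit : IsUnit (L.gram P₁ P₂ s)) (hΘ : Θ s = L.Theta P₁ P₂ s) (x : Fin n → ℝ) :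
    quad (L.valueDrift P₁ P₂ Θ s s) x ≤ quad (L.valueDrift P₁ P₂ 0 s s) x := by
  have hdet := (isUnit_iff_isUnit_det _).1 hunit
  have h1 : L.crossTerm P₁ P₂ s = -(L.gram P₁ P₂ s * Θ s) := by
    rw [hΘ, Theta, Matrix.mul_neg, neg_neg, ← Matrix.mul_assoc, mul_nonsing_inv _ hdet,
      Matrix.one_mul]
    rfl
  have hsymm' : (L.gram P₁ P₂ s)ᵀ = L.gram P₁ P₂ s := hsymm
  have h2 : L.valueDrift P₁ P₂ Θ s s =
      L.valueDrift P₁ P₂ 0 s s - (Θ s)ᵀ * L.gram P₁ P₂ s * Θ s := by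
    rw [valueDrift_eq_add hP hN hG, h1, transpose_neg, transpose_mul, hsymm', Matrix.mul_neg,
      Matrix.neg_mul, Matrix.mul_assoc]
    abel
  rw [h2, quad_sub, quad_conj]
  linarith [quad_nonneg hgram (Θ s *ᵥ x)]

lemma exists_bound_of_continuousOn {a b : ℕ} {A : ℝ → Matrix (Fin a) (Fin b) ℝ} {T : ℝ}
    (hA : ContinuousOn A (Icc 0 T)) : ∃ β, 0 ≤ β ∧ ∀ s ∈ Icc 0 T, ‖A s‖ ≤ β := by
  obtain ⟨β, hβ⟩ := isCompact_Icc.exists_bound_of_continuousOn hA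
  exact ⟨max β 0, le_max_right _ _, fun s hs => (hβ s hs).trans (le_max_left _ _)⟩

lemma continuousOn_closedA (hcoef : L.CoeffsContinuous) (hΘ : ContinuousOn Θ (Icc 0 L.T)) :
    ContinuousOn (L.closedA Θ) (Icc 0 L.T) :=
  hcoef.1.add (hcoef.2.1.matrix_mul hΘ)

lemma continuousOn_closedC (hcoef : L.CoeffsContinuous) (hΘ : ContinuousOn Θ (Icc 0 L.T)) :
    ContinuousOn (L.closedC Θ) (Icc 0 L.T) :=
  hcoef.2.2.1.add (hcoef.2.2.2.1.matrix_mul hΘ)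

lemma continuousOn_closedAh (hcoef : L.CoeffsContinuous) (hΘ : ContinuousOn Θ (Icc 0 L.T)) :
    ContinuousOn (L.closedAh Θ) (Icc 0 L.T) :=
  hcoef.2.2.2.2.1.add (hcoef.2.2.2.2.2.1.matrix_mul hΘ)

/-- Without feedback the drift of the quadratic cost grows at most linearly in the cost. -/
lemma exists_norm_valueDrift_zero_le (hcoef : L.CoeffsContinuous) (hreg : L.WeightsRegular) {r : ℝ}
    (hr : 0 ≤ r) : ∃ κ : ℝ, 0 ≤ κ ∧ ∀ (P₁ : ℝ → ℝ → Matrix (Fin n) (Fin n) ℝ)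
      (P₂ : ℝ → Matrix (Fin m) (Fin n) ℝ), ∀ s ∈ Icc 0 L.T, ∀ w : ℝ, ‖P₁ s s‖ ≤ w →
        ‖P₂ s‖ ^ 2 ≤ r * w → ‖L.valueDrift P₁ P₂ 0 s s‖ ≤ κ * (1 + w) := by
  obtain ⟨hA, hB, hC, hD, hAh, hBh, hCh, hDh⟩ := hcoef
  obtain ⟨hQ, hR, hM, hN, hG₁, hG₂, -⟩ := hreg
  obtain ⟨a, ha, hA⟩ := exists_bound_of_continuousOn hA
  obtain ⟨c, hc, hC⟩ := exists_bound_of_continuousOn hC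
  obtain ⟨ah, hah, hAh⟩ := exists_bound_of_continuousOn hAh
  obtain ⟨ch, hch, hCh⟩ := exists_bound_of_continuousOn hCh
  obtain ⟨dh, hdh, hDh⟩ := exists_bound_of_continuousOn hDh
  obtain ⟨q, hq, hQ⟩ := exists_bound_of_continuousOn (diag_kernel hQ)
  obtain ⟨μ, hμ, hM⟩ := exists_bound_of_continuousOn (diag_kernel hM)
  obtain ⟨ν, hν, hN⟩ := exists_bound_of_continuousOn (diag_kernel hN)
  obtain ⟨g, hg, hG⟩ := exists_bound_of_continuousOn hG₂.1.continuousOn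
  obtain ⟨z, hz⟩ : ∃ z, z = c * ν * c + μ + 2 * g * (a + ah + ch + dh * c) := ⟨_, rfl⟩
  have hz0 : 0 ≤ z := by rw [hz]; positivity
  obtain ⟨y, hy⟩ : ∃ y, y = q + 2 * g * ah := ⟨_, rfl⟩
  have hy0 : 0 ≤ y := by rw [hy]; positivity
  refine ⟨2 * a + c * c + y + z * r, by positivity, fun P₁ P₂ s hs w hw hp => ?_⟩
  have hw0 : 0 ≤ w := (norm_nonneg _).trans hw
  obtain ⟨p, hpdef⟩ : ∃ p, ‖P₂ s‖ = p := ⟨_, rfl⟩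
  have hp0 : 0 ≤ p := hpdef ▸ norm_nonneg _
  have hP₂ : ‖P₂ s‖ ≤ p := hpdef.le
  have hP₂' : ‖(P₂ s)ᵀ‖ ≤ p := (norm_transpose' _).trans_le hP₂
  rw [hpdef] at hp
  have hA' : ‖(L.A s)ᵀ‖ ≤ a := (norm_transpose' _).trans_le (hA s hs)
  have hC' : ‖(L.C s)ᵀ‖ ≤ c := (norm_transpose' _).trans_le (hC s hs)
  have hdr : ‖L.drift₂ P₂ 0 s‖ ≤ p * a + ah + ch * p + dh * p * c := by
    simp only [drift₂, closedA, closedAh, closedC, Pi.zero_apply, Matrix.mul_zero, add_zero]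
    have key := norm_add_le_of_le (norm_add_le_of_le (norm_add_le_of_le
      (l2_opNorm_mul_le_of_le hP₂ (hA s hs)) (hAh s hs)) (l2_opNorm_mul_le_of_le (hCh s hs) hP₂))
      (l2_opNorm_mul_le_of_le (l2_opNorm_mul_le_of_le (hDh s hs) hP₂) (hC s hs))
    exact key
  have hdr' := (norm_transpose' (L.drift₂ P₂ 0 s)).trans_le hdr
  have hd₁ : ‖L.drift₁ P₁ P₂ 0 s s‖ ≤
      w * a + a * w + c * w * c + q + p * μ * p + c * p * ν * p * c := by
    simp only [drift₁, closedA, closedC, Pi.zero_apply, Matrix.mul_zero, add_zero]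
    have key := norm_add_le_of_le (norm_add_le_of_le (norm_add_le_of_le (norm_add_le_of_le
      (norm_add_le_of_le (l2_opNorm_mul_le_of_le hw (hA s hs)) (l2_opNorm_mul_le_of_le hA' hw))
      (l2_opNorm_mul_le_of_le (l2_opNorm_mul_le_of_le hC' hw) (hC s hs))) (hQ s hs))
      (l2_opNorm_mul_le_of_le (l2_opNorm_mul_le_of_le hP₂' (hM s hs)) hP₂))
      (l2_opNorm_mul_le_of_le (l2_opNorm_mul_le_of_le (l2_opNorm_mul_le_of_le (l2_opNorm_mul_le_of_le hC' hP₂')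
        (hN s hs)) hP₂) (hC s hs))
    exact key
  have htot : ‖L.valueDrift P₁ P₂ 0 s s‖ ≤
      (w * a + a * w + c * w * c + q + p * μ * p + c * p * ν * p * c) +
      (p * g * (p * a + ah + ch * p + dh * p * c) + (p * a + ah + ch * p + dh * p * c) * g * p) := by
    have key := norm_add_le_of_le hd₁ (norm_add_le_of_le
      (l2_opNorm_mul_le_of_le (l2_opNorm_mul_le_of_le hP₂' (hG s hs)) hdr)
      (l2_opNorm_mul_le_of_le (l2_opNorm_mul_le_of_le hdr' (hG s hs)) hP₂))
    exact key
  -- Without feedback the bound has degree two in `p = ‖P₂ s‖`. The linear term is absorbed here,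
  -- and `p² ≤ r w` then makes everything affine in `w`.
  have hp1 : p ≤ 1 + p ^ 2 := by nlinarith [sq_nonneg (p - 1)]
  calc _ ≤ _ := htot
    _ = (2 * a + c * c) * w + q + (z - 2 * g * ah) * p ^ 2 + 2 * g * ah * p := by rw [hz]; ring
    _ ≤ (2 * a + c * c) * w + q + (z - 2 * g * ah) * p ^ 2 + 2 * g * ah * (1 + p ^ 2) := by gcongr
    _ = (2 * a + c * c) * w + y + z * p ^ 2 := by rw [hy]; ring
    _ ≤ (2 * a + c * c) * w + y + z * (r * w) := by gcongr
    _ ≤ _ := by nlinarith [mul_nonneg hz0 hr, mul_nonneg hy0 hw0, mul_nonneg ha ha, mul_nonneg hc hc]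

namespace IsDampedFlow

lemma exists_bound (h : L.IsDampedFlow χ Θ P₁ P₂) (hcoef : L.CoeffsContinuous) :
    ∃ α γ : ℝ, 0 ≤ α ∧ 0 ≤ γ ∧
      ∀ s ∈ Icc 0 L.T, ‖L.closedA Θ s‖ ≤ α ∧ ‖L.closedC Θ s‖ ≤ γ := by
  obtain ⟨α, hα, h1⟩ := exists_bound_of_continuousOn (continuousOn_closedA hcoef h.cont_feedback)
  obtain ⟨γ, hγ, h2⟩ := exists_bound_of_continuousOn (continuousOn_closedC hcoef h.cont_feedback)
  exact ⟨α, γ, hα, hγ, fun s hs => ⟨h1 s hs, h2 s hs⟩⟩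

lemma source_isSymm (hreg : L.WeightsRegular) {t s : ℝ} (ht : t ∈ Icc 0 L.T)
    (hs : s ∈ Icc 0 L.T) : (L.source P₂ Θ t s)ᵀ = L.source P₂ Θ t s := by
  obtain ⟨hQ, hR, hM, hN, hG₁, hG₂, -⟩ := hreg
  have hQ' : (L.Q t s)ᵀ = L.Q t s := hQ.2 t ht s hs
  have hR' : (L.R t s)ᵀ = L.R t s := hR.2 t ht s hs
  have hM' : (L.M t s)ᵀ = L.M t s := hM.2 t ht s hs
  have hN' : (L.N t s)ᵀ = L.N t s := hN.2 t ht s hs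
  simp only [source, transpose_add, transpose_mul, transpose_transpose, hQ', hR', hM', hN',
    Matrix.mul_assoc]

/-- The defect `P₁ᵀ - P₁` solves the homogeneous Lyapunov equation with zero terminal value, since
the source is symmetric. -/
lemma isSymm (h : L.IsDampedFlow χ Θ P₁ P₂) (hcoef : L.CoeffsContinuous)
    (hreg : L.WeightsRegular) {t s : ℝ} (ht : t ∈ Icc 0 L.T) (hs : s ∈ Icc 0 L.T) :
    (P₁ t s).IsSymm := by
  obtain ⟨α, γ, hα, hγ, hb⟩ := h.exists_bound hcoef
  refine sub_eq_zero.1 (eq_zero_of_norm_deriv_le_backward (f := fun s => (P₁ t s)ᵀ - P₁ t s)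
    (K := 2 * α + γ ^ 2) (fun s hs => ((h.deriv₁ t ht s hs).matrix_transpose.sub
      (h.deriv₁ t ht s hs))) ?_ (fun s hs => ?_) (by positivity) s hs)
  · rw [h.terminal₁ t ht, sub_eq_zero]
    exact hreg.2.2.2.2.1.2 t ht
  · have : (-(χ s • L.drift₁ P₁ P₂ Θ t s))ᵀ - -(χ s • L.drift₁ P₁ P₂ Θ t s) =
        -(χ s • lyap (L.closedA Θ s) (L.closedC Θ s) ((P₁ t s)ᵀ - P₁ t s)) := by
      rw [drift₁_eq_lyap_add_source, transpose_neg, transpose_smul, transpose_add,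
        source_isSymm hreg ht hs, lyap_sub, lyap_transpose]
      simp only [smul_add, smul_sub]
      abel
    rw [this, norm_neg, norm_smul, Real.norm_of_nonneg (h.factor_nonneg s)]
    exact (mul_le_of_le_one_left (norm_nonneg _) (h.factor_le_one s)).trans
      (norm_lyap_le (hb s hs).1 (hb s hs).2 _)

lemma posSemidef (h : L.IsDampedFlow χ Θ P₁ P₂) (hcoef : L.CoeffsContinuous)
    (hreg : L.WeightsRegular) (hpos : L.WeightsPositive) {t s : ℝ} (ht : 0 ≤ t) (hts : t ≤ s)
    (hs : s ≤ L.T) : (P₁ t s).PosSemidef := by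
  obtain ⟨α, γ, hα, hγ, hb⟩ := h.exists_bound hcoef
  obtain ⟨δ, hδ, hpos⟩ := hpos
  have htT : t ≤ L.T := hts.trans hs
  have hsub : Icc t L.T ⊆ Icc 0 L.T := Icc_subset_Icc_left ht
  refine posSemidef_iff_quad.2 ⟨h.isSymm hcoef hreg ⟨ht, htT⟩ ⟨ht.trans hts, hs⟩, ?_⟩
  refine quad_nonneg_of_lyapunov (a := t) (b := L.T) (A := L.closedA Θ) (C := L.closedC Θ)
    (S := fun s => L.source P₂ Θ t s) h.factor_nonneg
    h.factor_le_one (fun s hs => (hb s (hsub hs)).1) (fun s hs => (hb s (hsub hs)).2)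
    (fun s hs x => ?_) (fun s hs => ?_) (fun x => ?_) s ⟨hts, hs⟩
  · obtain ⟨h1, h2, h3, h4, h5, h6⟩ := hpos t s ht hs.1 hs.2
    have h1' : 0 ≤ L.R t s :=
      (nonneg_iff_posSemidef.2 (PosSemidef.one.smul hδ.le)).trans h1
    rw [source, quad_add, quad_add, quad_add, quad_conj, quad_conj, quad_conj]
    have := quad_nonneg h1' (Θ s *ᵥ x)
    have := quad_nonneg h3 x
    have := quad_nonneg h4 (P₂ s *ᵥ x)
    have := quad_nonneg h5 ((P₂ s * L.closedC Θ s) *ᵥ x)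
    positivity
  · rw [← drift₁_eq_lyap_add_source]
    exact (h.deriv₁ t ⟨ht, htT⟩ s (hsub hs)).mono hsub
  · rw [h.terminal₁ t ⟨ht, htT⟩]
    exact quad_nonneg (hpos t t ht le_rfl htT).2.2.2.2.2 x

/-- `P₁(τ,·) - P₁(t,·)` solves a Lyapunov equation on `[τ,T]`. Both share `Θ` and `P₂`, so the
source and the terminal value are differences of weights, nonnegative by monotonicity. -/
lemma quad_mono (h : L.IsDampedFlow χ Θ P₁ P₂) (hcoef : L.CoeffsContinuous)
    (hmono : L.WeightsMonotone) {t τ s : ℝ} (ht : 0 ≤ t) (htτ : t ≤ τ)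
    (hτs : τ ≤ s) (hs : s ≤ L.T) (x : Fin n → ℝ) : quad (P₁ t s) x ≤ quad (P₁ τ s) x := by
  obtain ⟨α, γ, hα, hγ, hb⟩ := h.exists_bound hcoef
  obtain ⟨Qh, G₁h, Rh, Mh, Nh, G₂h, -, -, -, -, -, -, hmono⟩ := hmono
  have hτ : 0 ≤ τ := ht.trans htτ
  have hτT : τ ≤ L.T := hτs.trans hs
  have htI : t ∈ Icc 0 L.T := ⟨ht, htτ.trans hτT⟩
  have hsub : Icc τ L.T ⊆ Icc 0 L.T := Icc_subset_Icc_left hτ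
  rw [← sub_nonneg, ← quad_sub]
  refine quad_nonneg_of_lyapunov (a := τ) (b := L.T) (P := fun s => P₁ τ s - P₁ t s)
    (A := L.closedA Θ) (C := L.closedC Θ) (S := fun s => L.source P₂ Θ τ s - L.source P₂ Θ t s)
    h.factor_nonneg h.factor_le_one (fun s hs => (hb s (hsub hs)).1)
    (fun s hs => (hb s (hsub hs)).2) (fun s hs x => ?_) (fun s hs => ?_) (fun x => ?_) s ⟨hτs, hs⟩ x
  · obtain ⟨h1, h2, h3, h4, h5, h6⟩ := hmono t τ s ht htτ hs.1 hs.2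
    simp only [source, quad_sub, quad_add, quad_conj]
    have := quad_le_quad h1.1 x
    have := quad_le_quad h2.1 (Θ s *ᵥ x)
    have := quad_le_quad h3.1 (P₂ s *ᵥ x)
    have := quad_le_quad h4.1 ((P₂ s * L.closedC Θ s) *ᵥ x)
    linarith
  · have h1 := ((h.deriv₁ τ ⟨hτ, hτT⟩ s (hsub hs)).sub (h.deriv₁ t htI s (hsub hs))).mono hsub
    rw [drift₁_eq_lyap_add_source, drift₁_eq_lyap_add_source] at h1
    refine h1.congr_deriv ?_
    rw [lyap_sub]
    simp only [smul_add, smul_sub]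
    abel
  · simp only [h.terminal₁ τ ⟨hτ, hτT⟩, h.terminal₁ t htI]
    rw [quad_sub, sub_nonneg]
    exact quad_le_quad (hmono t τ τ ht htτ le_rfl hτT).2.2.2.2.1.1 x

end IsDampedFlow

end LQData

/-! ### A priori bounds independent of the damping factor. -/

namespace LQData

open Matrix

variable {n k m : ℕ} {L : LQData n k m} {χ : ℝ → ℝ} {Θ Θ' : ℝ → Matrix (Fin k) (Fin n) ℝ}
  {P₁ : ℝ → ℝ → Matrix (Fin n) (Fin n) ℝ} {P₂ : ℝ → Matrix (Fin m) (Fin n) ℝ}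

lemma drift₁_congr {t s : ℝ} (h : Θ s = Θ' s) : L.drift₁ P₁ P₂ Θ t s = L.drift₁ P₁ P₂ Θ' t s := by
  simp only [drift₁, closedA, closedC, h]

lemma drift₂_congr {s : ℝ} (h : Θ s = Θ' s) : L.drift₂ P₂ Θ s = L.drift₂ P₂ Θ' s := by
  simp only [drift₂, closedA, closedAh, closedC, h]

namespace IsDampedFlow

lemma hasDerivWithinAt_value (h : L.IsDampedFlow χ Θ P₁ P₂) {t s : ℝ} (ht : t ∈ Icc 0 L.T)
    (hs : s ∈ Icc 0 L.T) : HasDerivWithinAt (fun r => L.value P₁ P₂ t r)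
      (-(χ s • L.valueDrift P₁ P₂ Θ t s)) (Icc 0 L.T) s := by
  have h2 := h.deriv₂ s hs
  refine ((h.deriv₁ t ht s hs).add ((h2.matrix_transpose.matrix_mul
    (hasDerivWithinAt_const s (Icc 0 L.T) (L.G₂ t))).matrix_mul h2)).congr_deriv ?_
  simp only [valueDrift, transpose_neg, transpose_smul, Matrix.mul_zero, zero_add, Matrix.mul_neg,
    Matrix.neg_mul, Matrix.mul_smul, Matrix.smul_mul, smul_add]
  abel

lemma continuousOn_valueDrift (h : L.IsDampedFlow χ Θ P₁ P₂) (hcoef : L.CoeffsContinuous)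
    (hreg : L.WeightsRegular) : ContinuousOn (fun p : ℝ × ℝ => L.valueDrift P₁ P₂ Θ p.1 p.2)
      (Icc 0 L.T ×ˢ Icc 0 L.T) := by
  have hA := continuousOn_closedA hcoef h.cont_feedback
  have hC := continuousOn_closedC hcoef h.cont_feedback
  have hAh := continuousOn_closedAh hcoef h.cont_feedback
  obtain ⟨-, -, -, -, -, -, hCh, hDh⟩ := hcoef
  obtain ⟨hQ, hR, hM, hN, hG₁, hG₂, -⟩ := hreg
  have hsnd : MapsTo (Prod.snd : ℝ × ℝ → ℝ) (Icc 0 L.T ×ˢ Icc 0 L.T) (Icc 0 L.T) := fun p hp => hp.2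
  have hd₂ : ContinuousOn (L.drift₂ P₂ Θ) (Icc 0 L.T) :=
    (((h.cont₂.matrix_mul hA).add hAh).add (hCh.matrix_mul h.cont₂)).add
      ((hDh.matrix_mul h.cont₂).matrix_mul hC)
  replace hd₂ := hd₂.comp continuousOn_snd hsnd
  have hG := hG₂.1.continuousOn.comp continuousOn_fst
    (fun p hp => hp.1 : MapsTo (Prod.fst : ℝ × ℝ → ℝ) (Icc 0 L.T ×ˢ Icc 0 L.T) (Icc 0 L.T))
  replace hA := hA.comp continuousOn_snd hsnd
  replace hC := hC.comp continuousOn_snd hsnd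
  have hΘ := h.cont_feedback.comp continuousOn_snd hsnd
  have hP₂ := h.cont₂.comp continuousOn_snd hsnd
  have hP₁ := h.cont₁
  exact (((((((hP₁.matrix_mul hA).add (hA.matrix_transpose.matrix_mul hP₁)).add
    ((hC.matrix_transpose.matrix_mul hP₁).matrix_mul hC)).add hQ.1).add
    ((hΘ.matrix_transpose.matrix_mul hR.1).matrix_mul hΘ)).add
    ((hP₂.matrix_transpose.matrix_mul hM.1).matrix_mul hP₂)).add
    ((((hC.matrix_transpose.matrix_mul hP₂.matrix_transpose).matrix_mul hN.1).matrix_mul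
      hP₂).matrix_mul hC)).add
    (((hP₂.matrix_transpose.matrix_mul hG).matrix_mul hd₂).add
      ((hd₂.matrix_transpose.matrix_mul hG).matrix_mul hP₂))

lemma continuousOn_value_diag (h : L.IsDampedFlow χ Θ P₁ P₂) (hreg : L.WeightsRegular) :
    ContinuousOn (fun s => L.value P₁ P₂ s s) (Icc 0 L.T) :=
  (h.cont₁.comp (f := fun s : ℝ => (s, s)) (by fun_prop) fun s hs => ⟨hs, hs⟩).add
    ((h.cont₂.matrix_transpose.matrix_mul hreg.2.2.2.2.2.1.1.continuousOn).matrix_mul h.cont₂)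

/-- A bound of the diagonal cost bounds `P₁(s,s)` and `P₂(s)`. -/
lemma norm_le_of_value_le {δ w s : ℝ} (hδ : 0 < δ) (hw : 0 ≤ w) (hP : (P₁ s s).PosSemidef)
    (hG : δ • (1 : Matrix (Fin m) (Fin m) ℝ) ≤ L.G₂ s)
    (h : ∀ x, quad (L.value P₁ P₂ s s) x ≤ w * (x ⬝ᵥ x)) :
    ‖P₁ s s‖ ≤ w ∧ ‖P₂ s‖ ^ 2 ≤ δ⁻¹ * w := by
  simp only [value, quad_add, quad_conj] at h
  have h1 : ∀ x, δ * ((P₂ s *ᵥ x) ⬝ᵥ (P₂ s *ᵥ x)) ≤ quad (L.G₂ s) (P₂ s *ᵥ x) := fun x => by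
    have := quad_le_quad hG (P₂ s *ᵥ x)
    rwa [quad_smul, quad_one] at this
  constructor
  · refine hP.norm_le_of_quad_le hw fun x => ?_
    have h2 := mul_nonneg hδ.le (self_dotProduct_nonneg (P₂ s *ᵥ x))
    linarith [h x, h1 x]
  · refine norm_sq_le_of_quad_le (by positivity) fun x => ?_
    have h2 := (posSemidef_iff_quad.1 hP).2 x
    rw [mul_assoc, inv_mul_eq_div, le_div_iff₀ hδ]
    linarith [h x, h1 x]

-- Only the second argument of `V(s,·)` moves, from `r` to `s`. By joint continuity the damped drift
-- on this short segment is within one of its value at `(r,r)`, whence the error `(r - s) |x|²`.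
open Filter Topology in
lemma eventually_value_le (h : L.IsDampedFlow χ Θ P₁ P₂) (hcoef : L.CoeffsContinuous)
    (hreg : L.WeightsRegular) {r : ℝ} (hr : r ∈ Ioc 0 L.T) :
    ∀ᶠ s in 𝓝[<] r, s ∈ Icc 0 L.T ∧ s < r ∧ ∀ x, quad (L.value P₁ P₂ s s) x ≤
      quad (L.value P₁ P₂ s r) x +
        (r - s) * (χ r * quad (L.valueDrift P₁ P₂ Θ r r) x + x ⬝ᵥ x) := by
  have hrI : r ∈ Icc 0 L.T := ⟨hr.1.le, hr.2⟩
  have hc : ContinuousOn (fun p : ℝ × ℝ => χ p.2 • L.valueDrift P₁ P₂ Θ p.1 p.2)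
      (Icc 0 L.T ×ˢ Icc 0 L.T) :=
    (h.cont_factor.comp continuousOn_snd fun p hp => hp.2).smul
      (h.continuousOn_valueDrift hcoef hreg)
  obtain ⟨ε, hε, hc⟩ := Metric.continuousWithinAt_iff.1 (hc (r, r) ⟨hrI, hrI⟩) 1 one_pos
  have h1 : ∀ᶠ s in 𝓝[<] r, r - ε < s :=
    nhdsWithin_le_nhds (lt_mem_nhds (by linarith))
  have h2 : ∀ᶠ s in 𝓝[<] r, 0 < s := nhdsWithin_le_nhds (lt_mem_nhds hr.1)
  filter_upwards [h1, h2, self_mem_nhdsWithin] with s hs1 hs2 hs3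
  rw [mem_Iio] at hs3
  have hsI : s ∈ Icc 0 L.T := ⟨hs2.le, hs3.le.trans hr.2⟩
  have hsub : Icc s r ⊆ Icc 0 L.T := Icc_subset_Icc hs2.le hr.2
  refine ⟨hsI, hs3, fun x => ?_⟩
  obtain ⟨Z, hZ⟩ : ∃ Z, Z = χ r • L.valueDrift P₁ P₂ Θ r r := ⟨_, rfl⟩
  -- Adding `u • Z` cancels the derivative at `(r,r)`, so the mean value inequality applies with
  -- constant one.
  have hmv := (convex_Icc s r).norm_image_sub_le_of_norm_hasDerivWithin_le
    (f := fun u => L.value P₁ P₂ s u + u • Z)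
    (f' := fun u => -(χ u • L.valueDrift P₁ P₂ Θ s u) + (1 : ℝ) • Z) (C := 1) (x := s) (y := r)
    (fun u hu => ((h.hasDerivWithinAt_value hsI (hsub hu)).mono hsub).add
      ((hasDerivAt_id u).smul_const Z).hasDerivWithinAt)
    (fun u hu => by
      have := hc (x := (s, u)) ⟨hsI, hsub hu⟩ (by
        rw [Prod.dist_eq, max_lt_iff, Real.dist_eq, Real.dist_eq]
        constructor <;> rw [abs_lt] <;> constructor <;> linarith [hu.1, hu.2])
      rw [dist_eq_norm, norm_sub_rev] at this
      rw [one_smul, hZ, neg_add_eq_sub]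
      exact this.le) (left_mem_Icc.2 hs3.le) (right_mem_Icc.2 hs3.le)
  rw [one_mul, Real.norm_of_nonneg (by linarith)] at hmv
  have h3 := neg_norm_le_quad
    (L.value P₁ P₂ s r + r • Z - (L.value P₁ P₂ s s + s • Z)) x
  have h4 := mul_le_mul_of_nonneg_right hmv (self_dotProduct_nonneg x)
  rw [quad_sub, quad_add, quad_add, quad_smul, quad_smul, hZ, quad_smul] at h3
  rw [hZ] at h4
  linarith

end IsDampedFlow

open Filter Topology in
/-- A priori bound of the diagonal cost, for a feedback that is the equilibrium feedback. -/
lemma exists_norm_diag_le (hpos : L.WeightsPositive) (hmono : L.WeightsMonotone)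
    (hcoef : L.CoeffsContinuous) (hreg : L.WeightsRegular) :
    ∃ w : ℝ, ∀ (χ : ℝ → ℝ) (Θ : ℝ → Matrix (Fin k) (Fin n) ℝ)
      (P₁ : ℝ → ℝ → Matrix (Fin n) (Fin n) ℝ) (P₂ : ℝ → Matrix (Fin m) (Fin n) ℝ),
      L.IsDampedFlow χ Θ P₁ P₂ →
      (∀ s ∈ Icc 0 L.T, (P₁ s s).PosSemidef → Θ s = L.Theta P₁ P₂ s) →
      ∀ s ∈ Icc 0 L.T, ‖P₁ s s‖ ≤ w ∧ ‖P₂ s‖ ≤ w := by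
  obtain ⟨δ, hδ, hpos'⟩ := id hpos
  obtain ⟨κ, hκ, hdrift⟩ := exists_norm_valueDrift_zero_le hcoef hreg (inv_nonneg.2 hδ.le)
  have hT := L.T_pos.le
  obtain ⟨c, hc⟩ : ∃ c, c = 1 + ‖L.G₁ L.T + L.Hᵀ * L.G₂ L.T * L.H‖ := ⟨_, rfl⟩
  have hc1 : 1 ≤ c := by rw [hc]; linarith [norm_nonneg (L.G₁ L.T + L.Hᵀ * L.G₂ L.T * L.H)]
  -- Since `c ≥ 1` gives `w ≥ 1`, `κ (1 + w) + 1 ≤ (2 κ + 1) w = K w`: the barrier outgrows both the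
  -- drift and the unit error.
  obtain ⟨K, hK⟩ : ∃ K, K = 2 * κ + 1 := ⟨_, rfl⟩
  have hK0 : 0 ≤ K := by rw [hK]; positivity
  obtain ⟨w, hw⟩ : ∃ w : ℝ → ℝ, ∀ s, w s = c * Real.exp (K * (L.T - s)) := ⟨_, fun _ => rfl⟩
  have hw1 : ∀ s ∈ Icc 0 L.T, 1 ≤ w s := fun s hs => by
    rw [hw]
    exact one_le_mul_of_one_le_of_one_le hc1
      (Real.one_le_exp (mul_nonneg hK0 (by linarith [hs.2])))
  have hw0 : ∀ s ∈ Icc 0 L.T, w s ≤ w 0 := fun s hs => by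
    rw [hw, hw]
    gcongr
    exact hs.1
  have hwcont : Continuous w := by
    rw [show w = fun s => c * Real.exp (K * (L.T - s)) from funext hw]
    fun_prop
  refine ⟨max (w 0) (1 + δ⁻¹ * w 0), fun χ Θ P₁ P₂ h hΘ => ?_⟩
  have hpsd : ∀ s ∈ Icc 0 L.T, (P₁ s s).PosSemidef := fun s hs =>
    h.posSemidef hcoef hreg hpos hs.1 le_rfl hs.2
  suffices key : Icc 0 L.T ⊆ {s | ∀ x, quad (L.value P₁ P₂ s s) x ≤ w s * (x ⬝ᵥ x)} by
    intro s hs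
    have hG := (hpos' s s hs.1 le_rfl hs.2).2.1
    obtain ⟨h1, h2⟩ := IsDampedFlow.norm_le_of_value_le hδ (zero_le_one.trans (hw1 s hs))
      (hpsd s hs) hG (key hs)
    refine ⟨(h1.trans (hw0 s hs)).trans (le_max_left _ _), le_trans ?_ (le_max_right _ _)⟩
    have h3 : δ⁻¹ * w s ≤ δ⁻¹ * w 0 := by gcongr; exact hw0 s hs
    nlinarith [sq_nonneg (‖P₂ s‖ - 1)]
  refine Icc_subset_of_forall_mem_nhdsLT ?_ ?_ ?_
  · have : {s | ∀ x, quad (L.value P₁ P₂ s s) x ≤ w s * (x ⬝ᵥ x)} ∩ Icc 0 L.T =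
        ⋂ x, Icc 0 L.T ∩ (fun s => w s * (x ⬝ᵥ x) - quad (L.value P₁ P₂ s s) x) ⁻¹' Ici 0 := by
      ext s
      simp only [mem_inter_iff, mem_ofPred_eq, mem_iInter, mem_preimage, mem_Ici, sub_nonneg]
      exact ⟨fun h x => ⟨h.2, h.1 x⟩, fun h => ⟨fun x => (h x).2, (h 0).1⟩⟩
    rw [this]
    refine isClosed_iInter fun x => ?_
    exact ((hwcont.mul continuous_const).continuousOn.sub ((continuous_quad x).comp_continuousOn
      (h.continuousOn_value_diag hreg))).preimage_isClosed_of_isClosed isClosed_Icc isClosed_Ici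
  · intro x
    have hTI : L.T ∈ Icc 0 L.T := ⟨hT, le_rfl⟩
    rw [value, h.terminal₁ L.T hTI, h.terminal₂, hw, sub_self, mul_zero, Real.exp_zero, mul_one]
    refine (quad_le_norm _ x).trans ?_
    gcongr
    · exact self_dotProduct_nonneg x
    · linarith
  · rintro r ⟨hr, hr0, hrT⟩
    have hrI : r ∈ Icc 0 L.T := ⟨hr0.le, hrT⟩
    obtain ⟨hR, hG, hQ, hM, hN, hG₁⟩ := hpos' r r hrI.1 le_rfl hrI.2
    have hP := hpsd r hrI
    have hwr := hw1 r hrI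
    obtain ⟨h1, h2⟩ := IsDampedFlow.norm_le_of_value_le hδ (zero_le_one.trans hwr) hP hG hr
    have hbound := hdrift P₁ P₂ r hrI (w r) h1 h2
    have hgram := smul_one_le_gram (P₁ := P₁) (P₂ := P₂) hP hN hR
    have hgram0 : 0 ≤ L.gram P₁ P₂ r :=
      (nonneg_iff_posSemidef.2 (PosSemidef.one.smul hδ.le)).trans hgram
    have hPs := (posSemidef_iff_quad.1 hP).1
    have hNs := hreg.2.2.2.1.2 r hrI r hrI
    filter_upwards [h.eventually_value_le hcoef hreg ⟨hr0, hrT⟩] with s ⟨hsI, hsr, hs⟩ x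
    have hx := self_dotProduct_nonneg x
    have h3 : χ r * quad (L.valueDrift P₁ P₂ Θ r r) x ≤ κ * (1 + w r) * (x ⬝ᵥ x) := by
      have h4 := quad_valueDrift_le hPs hNs (hreg.2.2.2.2.2.1.2 r hrI)
        (gram_isSymm hPs hNs (hreg.2.1.2 r hrI r hrI)) hgram0 (isUnit_of_smul_one_le hδ hgram)
        (hΘ r hrI hP) x
      have h5 : quad (L.valueDrift P₁ P₂ Θ r r) x ≤ κ * (1 + w r) * (x ⬝ᵥ x) :=
        (h4.trans (quad_le_norm _ x)).trans (by gcongr)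
      calc _ ≤ χ r * (κ * (1 + w r) * (x ⬝ᵥ x)) :=
            mul_le_mul_of_nonneg_left h5 (h.factor_nonneg r)
        _ ≤ _ := mul_le_of_le_one_left (by positivity) (h.factor_le_one r)
    -- `V(s,r) ≤ V(r,r)` for `s < r`: moving the first argument off the diagonal only lowers the
    -- cost.
    have h6 : quad (L.value P₁ P₂ s r) x ≤ w r * (x ⬝ᵥ x) := by
      refine le_trans ?_ (hr x)
      obtain ⟨Qh, G₁h, Rh, Mh, Nh, G₂h, -, -, -, -, -, -, hmono'⟩ := id hmono
      have h7 := quad_le_quad (hmono' s r r hsI.1 hsr.le le_rfl hrT).2.2.2.2.2.1 (P₂ r *ᵥ x)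
      simp only [value, quad_add, quad_conj]
      exact add_le_add (h.quad_mono hcoef hmono hsI.1 hsr.le le_rfl hrT x) h7
    have h8 : w r + (r - s) * (κ * (1 + w r) + 1) ≤ w s := by
      have h9 : w s = w r * Real.exp (K * (r - s)) := by
        rw [hw, hw, mul_assoc, ← Real.exp_add]
        ring_nf
      have h10 := Real.add_one_le_exp (K * (r - s))
      have h11 : κ * (1 + w r) + 1 ≤ w r * K := by rw [hK]; nlinarith
      have h12 := mul_le_mul_of_nonneg_left h11 (show 0 ≤ r - s by linarith)
      rw [h9]
      nlinarith
    calc _ ≤ _ := hs x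
      _ ≤ w r * (x ⬝ᵥ x) + (r - s) * (κ * (1 + w r) * (x ⬝ᵥ x) + x ⬝ᵥ x) := by
          gcongr
      _ = (w r + (r - s) * (κ * (1 + w r) + 1)) * (x ⬝ᵥ x) := by ring
      _ ≤ _ := by gcongr

/-- A priori bound of the damped flows whose feedback is the equilibrium feedback. -/
lemma exists_norm_le (hpos : L.WeightsPositive) (hmono : L.WeightsMonotone)
    (hcoef : L.CoeffsContinuous) (hreg : L.WeightsRegular)
    {J : Matrix (Fin k) (Fin k) ℝ → Matrix (Fin k) (Fin k) ℝ} {K : NNReal} (hJ : LipschitzWith K J)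
    (hJinv : ∀ (P₁ : ℝ → ℝ → Matrix (Fin n) (Fin n) ℝ) (P₂ : ℝ → Matrix (Fin m) (Fin n) ℝ),
      ∀ s ∈ Icc 0 L.T, (P₁ s s).PosSemidef → J (L.gram P₁ P₂ s) = (L.gram P₁ P₂ s)⁻¹) :
    ∃ ρ : ℝ, 0 ≤ ρ ∧ ∀ (χ : ℝ → ℝ) (P₁ : ℝ → ℝ → Matrix (Fin n) (Fin n) ℝ)
      (P₂ : ℝ → Matrix (Fin m) (Fin n) ℝ),
      L.IsDampedFlow χ (fun s => L.regTheta J s (P₁ s s) (P₂ s)) P₁ P₂ →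
      ∀ s ∈ Icc 0 L.T, ‖P₂ s‖ ≤ ρ ∧ ∀ t ∈ Icc 0 L.T, ‖P₁ t s‖ ≤ ρ := by
  obtain ⟨w, hw⟩ := exists_norm_diag_le hpos hmono hcoef hreg
  obtain ⟨θ, hθ, hΘ⟩ := (unifLip_regTheta hcoef hreg hJ).lip w
  -- `σ` bounds the source of the Lyapunov equation, which is `field₁` with `0` in the slot of
  -- `P₁(t,s)`.
  obtain ⟨σ, hσ, hsource⟩ := (unifLip_field₁ hcoef hreg hJ).lip w
  obtain ⟨a, ha, hA⟩ := exists_bound_of_continuousOn hcoef.1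
  obtain ⟨b, hb, hB⟩ := exists_bound_of_continuousOn hcoef.2.1
  obtain ⟨c, hc, hC⟩ := exists_bound_of_continuousOn hcoef.2.2.1
  obtain ⟨d, hd, hD⟩ := exists_bound_of_continuousOn hcoef.2.2.2.1
  obtain ⟨g, hg, hG⟩ := exists_bound_of_continuousOn hreg.2.2.2.2.1.1.continuousOn
  obtain ⟨l, hl⟩ : ∃ l, l = 2 * (a + b * θ) + (c + d * θ) ^ 2 := ⟨_, rfl⟩
  have hl0 : 0 ≤ l := by rw [hl]; positivity
  refine ⟨max w ((1 + g) * Real.exp ((2 * (l + σ) + 1) * L.T)), le_max_of_le_right (by positivity),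
    fun χ P₁ P₂ h s hs => ?_⟩
  have hdiag := hw _ _ P₁ P₂ h fun s hs hP => regTheta_eq_Theta L (hJinv P₁ P₂ s hs hP)
  refine ⟨(hdiag s hs).2.trans (le_max_left _ _), fun t ht => le_trans ?_ (le_max_right _ _)⟩
  have hw0 : 0 ≤ w := (norm_nonneg _).trans (hdiag s hs).2
  -- With `Θ` controlled by the diagonal, the equation of `P₁(t,·)` is linear with bounded
  -- coefficients. The constant `c = 1 + g` dominates the terminal value and, being at least one,
  -- absorbs `σ`.
  have hgron := norm_le_exp_of_norm_deriv_le_backward (K := l + σ) (c := 1 + g)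
    (h.deriv₁ t ht) (by positivity) (by
      rw [h.terminal₁ t ht]
      linarith [hG t ht]) (fun r hr => ?_) (by positivity) s hs
  · refine hgron.trans ?_
    gcongr
    linarith [hs.1]
  · have hy : ‖((0 : Matrix (Fin n) (Fin n) ℝ), P₁ r r, P₂ r)‖ ≤ w :=
      max_le (by rwa [norm_zero]) (max_le (hdiag r hr).1 (hdiag r hr).2)
    have hΘr := (hΘ (⟨r, hr⟩, ⟨r, hr⟩) _ _ hy hy).1
    have h1 := (hsource (⟨t, ht⟩, ⟨r, hr⟩) _ _ hy hy).1
    have h2 : L.field₁ J t r ((0 : Matrix (Fin n) (Fin n) ℝ), P₁ r r, P₂ r) =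
        L.source P₂ (fun s => L.regTheta J s (P₁ s s) (P₂ s)) t r := by
      rw [field₁, drift₁_eq_lyap_add_source]
      simp only [lyap, source, closedC, Matrix.mul_zero, Matrix.zero_mul, add_zero, zero_add]
    simp only [h2] at h1
    have h3 := norm_lyap_le
      (norm_add_le_of_le (hA r hr) (l2_opNorm_mul_le_of_le (hB r hr) hΘr))
      (norm_add_le_of_le (hC r hr) (l2_opNorm_mul_le_of_le (hD r hr) hΘr)) (P₁ t r)
    rw [← hl] at h3
    rw [norm_neg, norm_smul, Real.norm_of_nonneg (h.factor_nonneg r), drift₁_eq_lyap_add_source]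
    refine (mul_le_of_le_one_left (norm_nonneg _) (h.factor_le_one r)).trans
      ((norm_add_le_of_le h3 h1).trans ?_)
    nlinarith [norm_nonneg (P₁ t r), mul_nonneg hl0 hg, mul_nonneg hσ hg,
      mul_nonneg hσ (norm_nonneg (P₁ t r))]

end LQData

/-! ### Existence and uniqueness for the equilibrium Riccati equation. -/

namespace LQData

open Matrix

variable {n k m : ℕ} {L : LQData n k m}
  {P₁ P₁' : ℝ → ℝ → Matrix (Fin n) (Fin n) ℝ} {P₂ P₂' : ℝ → Matrix (Fin m) (Fin n) ℝ}
  {J : Matrix (Fin k) (Fin k) ℝ → Matrix (Fin k) (Fin k) ℝ} {K : NNReal}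

lemma exists_regular_inverse (hpos : L.WeightsPositive) :
    ∃ (J : Matrix (Fin k) (Fin k) ℝ → Matrix (Fin k) (Fin k) ℝ) (K : NNReal), LipschitzWith K J ∧
      ∀ (P₁ : ℝ → ℝ → Matrix (Fin n) (Fin n) ℝ) (P₂ : ℝ → Matrix (Fin m) (Fin n) ℝ),
        ∀ s ∈ Icc 0 L.T, (P₁ s s).PosSemidef → J (L.gram P₁ P₂ s) = (L.gram P₁ P₂ s)⁻¹ := by
  obtain ⟨δ, hδ, hpos⟩ := hpos
  obtain ⟨J, K, hJ, hinv⟩ := exists_lipschitzWith_eq_inv k hδ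
  refine ⟨J, K, hJ, fun P₁ P₂ s hs hP => hinv _ ?_⟩
  obtain ⟨hR, -, -, -, hN, -⟩ := hpos s s hs.1 le_rfl hs.2
  exact smul_one_le_gram hP hN hR

lemma isUnit_gram_of_posSemidef (hpos : L.WeightsPositive) {s : ℝ} (hs : s ∈ Icc 0 L.T)
    (hP : (P₁ s s).PosSemidef) : IsUnit (L.gram P₁ P₂ s) := by
  obtain ⟨δ, hδ, hpos⟩ := hpos
  obtain ⟨hR, -, -, -, hN, -⟩ := hpos s s hs.1 le_rfl hs.2
  exact isUnit_of_smul_one_le hδ (smul_one_le_gram hP hN hR)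

/-- The order of choices matters: the bound `ρ` depends on `J` and the data but not on the cutoff,
so the cutoff radius can be taken equal to `ρ` afterwards, and then `χ = 1` on `[0,T]`. -/
lemma exists_isERESolution (hpos : L.WeightsPositive) (hmono : L.WeightsMonotone)
    (hcoef : L.CoeffsContinuous) (hreg : L.WeightsRegular) :
    ∃ (P₁ : ℝ → ℝ → Matrix (Fin n) (Fin n) ℝ) (P₂ : ℝ → Matrix (Fin m) (Fin n) ℝ),
      L.IsERESolution P₁ P₂ := by
  obtain ⟨J, K, hJ, hinv⟩ := exists_regular_inverse hpos
  obtain ⟨ρ, hρ, hbound⟩ := exists_norm_le hpos hmono hcoef hreg hJ hinv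
  obtain ⟨χ, P₁, P₂, h, hχ⟩ := exists_isDampedFlow hcoef hreg hJ ρ
  have hχ1 : ∀ s ∈ Icc 0 L.T, χ s = 1 := fun s hs =>
    hχ s hρ (hbound χ P₁ P₂ h s hs).2 (hbound χ P₁ P₂ h s hs).1
  have hpsd : ∀ t s : ℝ, 0 ≤ t → t ≤ s → s ≤ L.T → (P₁ t s).PosSemidef := fun t s ht hts hs =>
    h.posSemidef hcoef hreg hpos ht hts hs
  have hΘ : ∀ s ∈ Icc 0 L.T, L.regTheta J s (P₁ s s) (P₂ s) = L.Theta P₁ P₂ s := fun s hs =>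
    regTheta_eq_Theta L (hinv P₁ P₂ s hs (hpsd s s hs.1 le_rfl hs.2))
  refine ⟨P₁, P₂, ⟨h.cont₁.mono ?_, hpsd, h.cont₂, fun s hs =>
    isUnit_gram_of_posSemidef hpos hs (hpsd s s hs.1 le_rfl hs.2), fun t s ht hts hs => ?_,
    fun s hs => ?_, h.terminal₁, h.terminal₂⟩⟩
  · rintro p ⟨h1, h2, h3⟩
    exact ⟨⟨h1, h2.trans h3⟩, ⟨h1.trans h2, h3⟩⟩
  · have hsI : s ∈ Icc 0 L.T := ⟨ht.trans hts, hs⟩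
    have h1 := h.deriv₁ t ⟨ht, hts.trans hs⟩ s hsI
    rw [hχ1 s hsI, one_smul, drift₁_congr (hΘ s hsI)] at h1
    exact h1.mono (Icc_subset_Icc_left ht)
  · have h1 := h.deriv₂ s hs
    rwa [hχ1 s hs, one_smul, drift₂_congr (hΘ s hs)] at h1

namespace IsERESolution

lemma exists_norm_le (h : L.IsERESolution P₁ P₂) : ∃ r : ℝ, 0 ≤ r ∧
    (∀ t s : ℝ, 0 ≤ t → t ≤ s → s ≤ L.T → ‖P₁ t s‖ ≤ r) ∧ ∀ s ∈ Icc 0 L.T, ‖P₂ s‖ ≤ r := by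
  have hcompact : IsCompact {p : ℝ × ℝ | 0 ≤ p.1 ∧ p.1 ≤ p.2 ∧ p.2 ≤ L.T} := by
    refine (isCompact_Icc.prod isCompact_Icc : IsCompact (Icc 0 L.T ×ˢ Icc 0 L.T)).of_isClosed_subset
      ?_ ?_
    · exact (isClosed_le continuous_const continuous_fst).inter
        ((isClosed_le continuous_fst continuous_snd).inter
          (isClosed_le continuous_snd continuous_const))
    · rintro p ⟨h1, h2, h3⟩
      exact ⟨⟨h1, h2.trans h3⟩, ⟨h1.trans h2, h3⟩⟩
  obtain ⟨r₁, h1⟩ := hcompact.exists_bound_of_continuousOn h.continuousOn₁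
  obtain ⟨r₂, hr₂, h2⟩ := exists_bound_of_continuousOn h.continuousOn₂
  exact ⟨max r₁ r₂, le_max_of_le_right hr₂,
    fun t s ht hts hs => (h1 (t, s) ⟨ht, hts, hs⟩).trans (le_max_left _ _),
    fun s hs => (h2 s hs).trans (le_max_right _ _)⟩

lemma hasDerivWithinAt_field₁ (h : L.IsERESolution P₁ P₂)
    (hinv : ∀ s ∈ Icc 0 L.T, (P₁ s s).PosSemidef → J (L.gram P₁ P₂ s) = (L.gram P₁ P₂ s)⁻¹)
    {t s : ℝ} (ht : 0 ≤ t) (hts : t ≤ s) (hs : s ≤ L.T) :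
    HasDerivWithinAt (fun r => P₁ t r) (-L.field₁ J t s (P₁ t s, P₁ s s, P₂ s)) (Icc t L.T) s := by
  have hsI : s ∈ Icc 0 L.T := ⟨ht.trans hts, hs⟩
  have hΘ := regTheta_eq_Theta L (hinv s hsI (h.posSemidef₁ s s hsI.1 le_rfl hs))
  rw [field₁_eq, drift₁_congr (Θ' := L.Theta P₁ P₂) hΘ]
  exact h.deriv₁ t s ht hts hs

lemma hasDerivWithinAt_field₂ (h : L.IsERESolution P₁ P₂)
    (hinv : ∀ s ∈ Icc 0 L.T, (P₁ s s).PosSemidef → J (L.gram P₁ P₂ s) = (L.gram P₁ P₂ s)⁻¹)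
    {s : ℝ} (hs : s ∈ Icc 0 L.T) :
    HasDerivWithinAt P₂ (-L.field₂ J s (P₁ s s, P₁ s s, P₂ s)) (Icc 0 L.T) s := by
  have hΘ := regTheta_eq_Theta L (hinv s hs (h.posSemidef₁ s s hs.1 le_rfl hs.2))
  rw [field₂_eq, drift₂_congr (Θ' := L.Theta P₁ P₂) hΘ]
  exact h.deriv₂ s hs

/-- The weighted distance of two solutions can be halved, so it vanishes. -/
lemma eq_of_isERESolution (h : L.IsERESolution P₁ P₂) (h' : L.IsERESolution P₁' P₂')
    (hpos : L.WeightsPositive) (hcoef : L.CoeffsContinuous) (hreg : L.WeightsRegular) :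
    (∀ t s : ℝ, 0 ≤ t → t ≤ s → s ≤ L.T → P₁' t s = P₁ t s) ∧
      ∀ s ∈ Icc 0 L.T, P₂' s = P₂ s := by
  obtain ⟨J, K, hJ, hinv⟩ := exists_regular_inverse hpos
  obtain ⟨r, hr, hr₁, hr₂⟩ := h.exists_norm_le
  obtain ⟨r', hr', hr₁', hr₂'⟩ := h'.exists_norm_le
  obtain ⟨K₁, hK₁, hlip₁⟩ := (unifLip_field₁ hcoef hreg hJ).lip (max r r')
  obtain ⟨K₂, hK₂, hlip₂⟩ := (unifLip_field₂ hcoef hreg hJ).lip (max r r')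
  -- The weight `exp(l (T - s))` has `l / 2` larger than both Lipschitz constants; this makes the
  -- contraction factor `1/2`.
  obtain ⟨l, hl⟩ : ∃ l, l = 2 * (max K₁ K₂ + 1) := ⟨_, rfl⟩
  have hK0 : 0 ≤ max K₁ K₂ := le_max_of_le_left hK₁
  have hl0 : 0 ≤ l := by rw [hl]; positivity
  have hT := L.T_pos.le
  have hy : ∀ t s : ℝ, 0 ≤ t → t ≤ s → s ≤ L.T → ‖(P₁ t s, P₁ s s, P₂ s)‖ ≤ max r r' :=
    fun t s ht hts hs => (max_le (hr₁ t s ht hts hs) (max_le (hr₁ s s (ht.trans hts) le_rfl hs)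
      (hr₂ s ⟨ht.trans hts, hs⟩))).trans (le_max_left _ _)
  have hy' : ∀ t s : ℝ, 0 ≤ t → t ≤ s → s ≤ L.T → ‖(P₁' t s, P₁' s s, P₂' s)‖ ≤ max r r' :=
    fun t s ht hts hs => (max_le (hr₁' t s ht hts hs) (max_le (hr₁' s s (ht.trans hts) le_rfl hs)
      (hr₂' s ⟨ht.trans hts, hs⟩))).trans (le_max_right _ _)
  have hB : ∀ (c x : ℝ), HasDerivAt (fun s => c * Real.exp (l * (L.T - s)))
      (-(c * l * Real.exp (l * (L.T - x)))) x := fun c x => by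
    have := (((hasDerivAt_id' x).const_sub L.T).const_mul l).exp.const_mul c
    exact this.congr_deriv (by ring)
  -- The difference of the fields involves the diagonal, so the distance is bounded at all points of
  -- the triangle simultaneously. The differences vanish at `T`, and their derivatives stay strictly
  -- below the slope of the halved barrier.
  have hstep : ∀ c : ℝ, 0 < c →
      ((∀ t s : ℝ, 0 ≤ t → t ≤ s → s ≤ L.T →
        ‖P₁' t s - P₁ t s‖ ≤ c * Real.exp (l * (L.T - s))) ∧
      ∀ s ∈ Icc 0 L.T, ‖P₂' s - P₂ s‖ ≤ c * Real.exp (l * (L.T - s))) →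
      ((∀ t s : ℝ, 0 ≤ t → t ≤ s → s ≤ L.T →
        ‖P₁' t s - P₁ t s‖ ≤ c / 2 * Real.exp (l * (L.T - s))) ∧
      ∀ s ∈ Icc 0 L.T, ‖P₂' s - P₂ s‖ ≤ c / 2 * Real.exp (l * (L.T - s))) := by
    rintro c hc ⟨hc₁, hc₂⟩
    have hdist : ∀ t s : ℝ, 0 ≤ t → t ≤ s → s ≤ L.T →
        ‖(P₁ t s, P₁ s s, P₂ s) - (P₁' t s, P₁' s s, P₂' s)‖ ≤
          c * Real.exp (l * (L.T - s)) := fun t s ht hts hs => by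
      rw [norm_sub_rev]
      exact max_le (hc₁ t s ht hts hs) (max_le (hc₁ s s (ht.trans hts) le_rfl hs)
        (hc₂ s ⟨ht.trans hts, hs⟩))
    have hlt : ∀ s, max K₁ K₂ * (c * Real.exp (l * (L.T - s))) <
        -(-(c / 2 * l * Real.exp (l * (L.T - s)))) := fun s => by
      have : 0 < c * Real.exp (l * (L.T - s)) := by positivity
      rw [hl] at this ⊢
      linarith
    constructor
    · intro t s ht hts hs
      have htI : t ∈ Icc 0 L.T := ⟨ht, hts.trans hs⟩
      refine norm_le_of_norm_deriv_lt_backward (a := t) (b := L.T)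
        (f := fun s => P₁' t s - P₁ t s) (B := fun s => c / 2 * Real.exp (l * (L.T - s)))
        (fun x hx => (h'.hasDerivWithinAt_field₁ (hinv P₁' P₂') ht hx.1 hx.2).sub
          (h.hasDerivWithinAt_field₁ (hinv P₁ P₂) ht hx.1 hx.2)) ?_ (hB (c / 2))
        (fun x hx _ => ?_) s ⟨hts, hs⟩
      · rw [h.terminal₁ t htI, h'.terminal₁ t htI, sub_self, norm_zero]
        positivity
      · have hxI : x ∈ Icc 0 L.T := ⟨ht.trans hx.1, hx.2⟩
        have h1 := (hlip₁ (⟨t, htI⟩, ⟨x, hxI⟩) _ _ (hy t x ht hx.1 hx.2)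
          (hy' t x ht hx.1 hx.2)).2
        rw [neg_sub_neg]
        refine (h1.trans ?_).trans_lt (hlt x)
        exact mul_le_mul (le_max_left _ _) (hdist t x ht hx.1 hx.2) (norm_nonneg _) hK0
    · refine norm_le_of_norm_deriv_lt_backward
        (f := fun s => P₂' s - P₂ s) (B := fun s => c / 2 * Real.exp (l * (L.T - s)))
        (fun x hx => (h'.hasDerivWithinAt_field₂ (hinv P₁' P₂') hx).sub
          (h.hasDerivWithinAt_field₂ (hinv P₁ P₂) hx)) ?_ (hB (c / 2)) (fun x hx _ => ?_)
      · rw [h.terminal₂, h'.terminal₂, sub_self, norm_zero]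
        positivity
      · have h1 := (hlip₂ (⟨x, hx⟩, ⟨x, hx⟩) _ _ (hy x x hx.1 le_rfl hx.2)
          (hy' x x hx.1 le_rfl hx.2)).2
        rw [neg_sub_neg]
        refine (h1.trans ?_).trans_lt (hlt x)
        exact mul_le_mul (le_max_right _ _) (hdist x x hx.1 le_rfl hx.2) (norm_nonneg _) hK0
  have hiter : ∀ j : ℕ, (∀ t s : ℝ, 0 ≤ t → t ≤ s → s ≤ L.T →
        ‖P₁' t s - P₁ t s‖ ≤ (r + r' + 1) * (1 / 2) ^ j * Real.exp (l * (L.T - s))) ∧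
      ∀ s ∈ Icc 0 L.T,
        ‖P₂' s - P₂ s‖ ≤ (r + r' + 1) * (1 / 2) ^ j * Real.exp (l * (L.T - s)) := by
    intro j
    induction j with
    | zero =>
      have hexp : ∀ s ≤ L.T, r + r' ≤ (r + r' + 1) * (1 / 2) ^ 0 * Real.exp (l * (L.T - s)) :=
        fun s hs => by
          have := Real.one_le_exp (mul_nonneg hl0 (sub_nonneg.2 hs))
          rw [pow_zero, mul_one]
          nlinarith
      refine ⟨fun t s ht hts hs => ?_, fun s hs => ?_⟩
      · refine ((norm_sub_le _ _).trans ?_).trans (hexp s hs)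
        linarith [hr₁ t s ht hts hs, hr₁' t s ht hts hs]
      · refine ((norm_sub_le _ _).trans ?_).trans (hexp s hs.2)
        linarith [hr₂ s hs, hr₂' s hs]
    | succ j ih =>
      have := hstep _ (by positivity) ih
      rwa [show (r + r' + 1) * (1 / 2) ^ j / 2 = (r + r' + 1) * (1 / 2 : ℝ) ^ (j + 1) by ring]
        at this
  have hlim : ∀ s, Filter.Tendsto
      (fun j : ℕ => (r + r' + 1) * (1 / 2 : ℝ) ^ j * Real.exp (l * (L.T - s))) Filter.atTop
      (nhds 0) := fun s => by
    have := ((tendsto_pow_atTop_nhds_zero_of_lt_one (r := (1 / 2 : ℝ)) (by norm_num)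
      (by norm_num)).const_mul (r + r' + 1)).mul_const (Real.exp (l * (L.T - s)))
    simpa using this
  refine ⟨fun t s ht hts hs => ?_, fun s hs => ?_⟩
  · exact sub_eq_zero.1 (norm_le_zero_iff.1
      (ge_of_tendsto' (hlim s) fun j => (hiter j).1 t s ht hts hs))
  · exact sub_eq_zero.1 (norm_le_zero_iff.1 (ge_of_tendsto' (hlim s) fun j => (hiter j).2 s hs))

end IsERESolution

end LQData

theorem theorem4p2 {n k m : ℕ} (L : LQData n k m)
    (hpos : L.WeightsPositive) (hmono : L.WeightsMonotone)
    (hcoef : L.CoeffsContinuous) (hreg : L.WeightsRegular) :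
    ∃ (P₁ : ℝ → ℝ → Matrix (Fin n) (Fin n) ℝ) (P₂ : ℝ → Matrix (Fin m) (Fin n) ℝ),
      L.IsERESolution P₁ P₂ ∧
      ∀ (P₁' : ℝ → ℝ → Matrix (Fin n) (Fin n) ℝ) (P₂' : ℝ → Matrix (Fin m) (Fin n) ℝ),
        L.IsERESolution P₁' P₂' →
          (∀ t s : ℝ, 0 ≤ t → t ≤ s → s ≤ L.T → P₁' t s = P₁ t s) ∧
          (∀ s ∈ Set.Icc 0 L.T, P₂' s = P₂ s) := by
  obtain ⟨P₁, P₂, h⟩ := LQData.exists_isERESolution hpos hmono hcoef hreg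
  exact ⟨P₁, P₂, h, fun P₁' P₂' h' => h.eq_of_isERESolution h' hpos hcoef hreg⟩
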